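/- Let $\alpha\in\mathbb R\setminus\mathbb Q$ with continued fraction convergents $p_n/q_n$, and let $\beta(\alpha)=\limsup_{n\to\infty}\frac{\log q_{n+1}}{q_n}\in[0,\infty]$. Let $d\ge 1$ and let $v_d(x)=\sum_{k=-d}^{d}\hat v_k e^{2\pi i k x}$ be a real-valued trigonometric polynomial of degree $d$ (so $\hat v_{-k}=\overline{\hat v_k}$ and $\hat v_d\neq 0$). For $E\in\mathbb R$ let $L^{E,d}(x)\in\mathbb C^{2d\times 2d}$ be the transfer matrix of the long-range equation $\sum_{k=-d}^{d}\hat v_k u_{n+k}+2\cos(2\pi(x+n\alpha))u_n=Eu_n$: its first row is $$\frac1{\hat v_d}\bigl(-\hat v_{d-1},\dots,-\hat v_1,\;E-2\cos(2\pi x)-\hat v_0,\;-\hat v_{-1},\dots,-\hat v_{-d}\bigr),$$ its entries directly below the diagonal are $1$, and all its other entries are $0$. Let $C_d$ be the $d\times d$ upper triangular matrix with entries $(C_d)_{ij}=\hat v_{d-(j-i)}$ for $i\le j$, and let $$S_d=\begin{pmatrix}0&-C_d^*\\ C_d&0\end{pmatrix},\qquad J=\begin{pmatrix}0&1\\-1&0\end{pmatrix},\qquad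 \mathrm{HSp}(2d,2,\psi_d,\omega_1)=\{M\in\mathbb C^{2d\times 2}: M^*S_dM=J\}.$$ For $\epsilon>0$, $C^\omega_\epsilon(\mathbb R/\mathbb Z,*)$ denotes the $*$-valued functions on $\mathbb R/\mathbb Z$ that extend holomorphically to $\{|\operatorname{Im}x|<\epsilon\}$ (as $1$-periodic functions), and $\|F\|_\epsilon=\sup_{|\operatorname{Im}x|<\epsilon}\|F(x)\|$ with the spectral norm. For every $\epsilon>0$ and $c>0$ there exist $\delta_*>0$, $q_*>0$ and a subsequence $(p_{n_j}/q_{n_j})_j$ of the convergents of $\alpha$ such that the following holds. For every $j$ with $q_{n_j}>q_*$ and every $E\in\mathbb R$ with $|E|\le 3+\sup_{x\in\mathbb R}|v_d(x)|$, there are no $\rho\in C^\omega_\epsilon(\mathbb R/\mathbb Z,\mathbb R)$ and $B\in C^\omega_\epsilon(\mathbb R/\mathbb Z,\mathrm{HSp}(2d,2,\psi_d,\omega_1))$ with $$\bigl\|L^{E,d}(x)B(x)-B(x+\alpha)\,e^{2\pi i\rho(x)}I_2\bigr\|_\epsilon\le e^{(-c+\delta_*)q_{n_j}}\quad\text{and}\quad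 \|B\|_\epsilon\le e^{\delta_* q_{n_j}}.$$ Moreover, if $\beta(\alpha)>0$, then this subsequence also satisfies $q_{n_j+1}>e^{(\beta(\alpha)-o(1))q_{n_j}}$ (that is, for every real $b<\beta(\alpha)$ one has $q_{n_j+1}>e^{b\,q_{n_j}}$ for all large $j$), and the same statement, with the same $\delta_*$ and $q_*$, holds with $B(x+\alpha)$ replaced by $B(x+p_{n_j}/q_{n_j})$. -/

import Mathlib

open scoped ENNReal

noncomputable section

namespace LongRange

/-- The denominator `q_n` of the `n`-th continued fraction convergent of `α`. -/
def q (α : ℝ) (n : ℕ) : ℝ := (GenContFract.of α).dens n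

/-- The `n`-th continued fraction convergent `p_n / q_n` of `α`. -/
def conv (α : ℝ) (n : ℕ) : ℝ := (GenContFract.of α).convs n

/-- `β(α) = limsup (log q_{n+1}) / q_n`, with values in the extended reals (it may be `+∞`). -/
def beta (α : ℝ) : EReal :=
  Filter.limsup (fun n : ℕ => ((Real.log (q α (n + 1)) / q α n : ℝ) : EReal)) Filter.atTop

/-- `v : ℤ → ℂ` is the family of Fourier coefficients of a real-valued trigonometric polynomial of
degree exactly `d`. -/
structure IsRealTrigPoly (d : ℕ) (v : ℤ → ℂ) : Prop where
  real : ∀ k : ℤ, v (-k) = star (v k)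
  degree_le : ∀ k : ℤ, (d : ℤ) < |k| → v k = 0
  leading : v d ≠ 0

/-- The trigonometric polynomial `v_d(x) = ∑_{|k| ≤ d} v_k e^{2πikx}`. -/
def potential (d : ℕ) (v : ℤ → ℂ) (x : ℝ) : ℂ :=
  ∑ k ∈ Finset.Icc (-(d : ℤ)) d, v k * Complex.exp (2 * Real.pi * Complex.I * k * x)

/-- The transfer matrix `L^{E,d}(z)` of the eigenvalue equation
`∑_{|k| ≤ d} v_k u_{n+k} + 2 cos(2π(x + nα)) u_n = E u_n`, acting on the column
`(u_{n+d-1}, …, u_{n-d})`, so that the column with index `j` carries the coefficient `v_{d-1-j}`. -/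
def transfer (d : ℕ) (v : ℤ → ℂ) (E : ℝ) (z : ℂ) : Matrix (Fin (d + d)) (Fin (d + d)) ℂ :=
  Matrix.of fun i j =>
    if (i : ℕ) = 0 then
      ((if (j : ℕ) + 1 = d then (E : ℂ) - 2 * Complex.cos (2 * Real.pi * z) else 0)
        - v ((d : ℤ) - 1 - (j : ℕ))) / v d
    else if (i : ℕ) = (j : ℕ) + 1 then 1 else 0

/-- The upper triangular Toeplitz matrix `C_d` with first row `v_d, …, v_1`. -/
def toeplitzC (d : ℕ) (v : ℤ → ℂ) : Matrix (Fin d) (Fin d) ℂ :=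
  Matrix.of fun i j => if i ≤ j then v ((d : ℤ) + (i : ℕ) - (j : ℕ)) else 0

/-- The matrix `S_d = [[0, -C_d^*], [C_d, 0]]` of the Hermitian-symplectic form `ψ_d`. -/
def formS (d : ℕ) (v : ℤ → ℂ) : Matrix (Fin (d + d)) (Fin (d + d)) ℂ :=
  Matrix.reindex finSumFinEquiv finSumFinEquiv
    (Matrix.fromBlocks 0 (-(toeplitzC d v).conjTranspose) (toeplitzC d v) 0)

/-- The matrix of the standard form `ω_1` on `ℂ²`. -/
def formJ : Matrix (Fin 2) (Fin 2) ℂ := !![0, 1; -1, 0]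

/-- `HSp(2d, 2, ψ_d, ω_1)`. -/
def HSp (d : ℕ) (v : ℤ → ℂ) : Set (Matrix (Fin (d + d)) (Fin 2) ℂ) :=
  {M | M.conjTranspose * formS d v * M = formJ}

/-- The complex strip `|Im z| < ε`. -/
def strip (ε : ℝ) : Set ℂ := {z | |z.im| < ε}

/-- A complex-valued function on `ℝ/ℤ` with a holomorphic extension to the strip, given by that
extension. Only the values of `f` on the strip matter. -/
def IsStripAnalytic (ε : ℝ) (f : ℂ → ℂ) : Prop :=
  DifferentiableOn ℂ f (strip ε) ∧ ∀ z ∈ strip ε, f (z + 1) = f z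

open scoped Matrix.Norms.L2Operator in
/-- `‖F‖_ε`: the supremum over the strip of the spectral norm. -/
def stripNorm {m n : ℕ} (ε : ℝ) (F : ℂ → Matrix (Fin m) (Fin n) ℂ) : ℝ≥0∞ :=
  ⨆ z ∈ strip ε, ‖F z‖ₑ

/-- There are `ρ ∈ C^ω_ε(ℝ/ℤ, ℝ)` and `B ∈ C^ω_ε(ℝ/ℤ, HSp(2d, 2, ψ_d, ω_1))` with
`‖L^{E,d}(x) B(x) - B(x + ω) e^{2πiρ(x)} I₂‖_ε ≤ η` and `‖B‖_ε ≤ K`. -/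
def AlmostConjugate (d : ℕ) (v : ℤ → ℂ) (E ω ε η K : ℝ) : Prop :=
  ∃ (ρ : ℂ → ℂ) (B : ℂ → Matrix (Fin (d + d)) (Fin 2) ℂ),
    IsStripAnalytic ε ρ ∧ (∀ x : ℝ, (ρ x).im = 0) ∧
    (∀ i j, IsStripAnalytic ε fun z => B z i j) ∧ (∀ x : ℝ, B x ∈ HSp d v) ∧
    stripNorm ε (fun z => transfer d v E z * B z -
      B (z + ω) * (Complex.exp (2 * Real.pi * Complex.I * ρ z) • (1 : Matrix (Fin 2) (Fin 2) ℂ)))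
        ≤ ENNReal.ofReal η ∧
    stripNorm ε B ≤ ENNReal.ofReal K

end LongRange

end

/-!
Suppose that `ρ` and `B` exist for some `E` and a large denominator `q`. The Hermitian-symplectic
relation bounds `B` from below, so comparing the transfer cocycle with its almost invariant section
bounds the imaginary parts of the Birkhoff sums of `ρ` up to time `κq` by a small multiple of `q`.
Both `α` and `p_n / q_n` have divisors `|e^{2πikω} - 1| ≥ 1 / q` for `0 < |k| ≤ q / 2`. Together
with the Birkhoff sums this solves the cohomological equation for `ρ` up to an error exponentially
small in `q`, with a solution that is only a small multiple of `q`. Hence `ρ` may be assumed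
constant.

With a constant multiplier, Aubry duality applies: the Fourier coefficients of the middle component
of each of the two columns almost solve one and the same second order difference equation. They
decay exponentially, so their Wronskian is tiny and some unit combination of the columns is tiny
everywhere, which contradicts the lower bound on `B`.
-/

noncomputable section

namespace LongRange

open Complex Filter MeasureTheory
open scoped Matrix Topology

section Character

/-- The character `e(z) = e^{2πiz}` of `ℂ/ℤ`. -/
def ex (z : ℂ) : ℂ := Complex.exp (2 * Real.pi * I * z)

theorem ex_zero : ex 0 = 1 := by simp [ex]

theorem ex_add (z w : ℂ) : ex (z + w) = ex z * ex w := by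
  simp only [ex, mul_add, Complex.exp_add]

theorem ex_intCast (k : ℤ) : ex k = 1 := by
  rw [ex, mul_comm]
  exact Complex.exp_int_mul_two_pi_mul_I k

theorem ex_natCast_mul (n : ℕ) (z : ℂ) : ex (n * z) = ex z ^ n := by
  rw [ex, ex, ← Complex.exp_nat_mul]
  ring_nf

theorem ex_ofReal (x : ℝ) : ex x = Complex.exp (I * ((2 * Real.pi * x : ℝ) : ℂ)) := by
  rw [ex]
  push_cast
  ring_nf

theorem norm_ex (z : ℂ) : ‖ex z‖ = Real.exp (-(2 * Real.pi * z.im)) := by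
  simp [ex, Complex.norm_exp]

theorem norm_ex_of_im_eq_zero {z : ℂ} (h : z.im = 0) : ‖ex z‖ = 1 := by
  simp [norm_ex, h]

theorem differentiable_ex : Differentiable ℂ ex := by
  unfold ex
  fun_prop

theorem continuous_ex : Continuous ex := differentiable_ex.continuous

end Character

section Strip

variable {ε : ℝ} {z : ℂ} {f g : ℂ → ℂ}

theorem ofReal_mem_strip (hε : 0 < ε) (x : ℝ) : (x : ℂ) ∈ strip ε := by
  simpa [strip] using hε

theorem add_ofReal_mem_strip (hz : z ∈ strip ε) (x : ℝ) : z + x ∈ strip ε := by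
  simpa [strip] using hz

theorem star_mem_strip (hz : z ∈ strip ε) : star z ∈ strip ε := by
  simpa [strip] using hz

theorem isOpen_strip (ε : ℝ) : IsOpen (strip ε) :=
  isOpen_lt (by fun_prop) continuous_const

theorem convex_strip (ε : ℝ) : Convex ℝ (strip ε) := by
  have hpre : strip ε = Complex.imLm ⁻¹' Set.Ioo (-ε) ε := by
    ext z
    simp [strip, abs_lt]
  rw [hpre]
  exact (convex_Ioo _ _).linear_preimage _

theorem eqOn_strip_of_forall_ofReal (hε : 0 < ε) (hf : DifferentiableOn ℂ f (strip ε))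
    (hg : DifferentiableOn ℂ g (strip ε)) (h : ∀ x : ℝ, f x = g x) :
    Set.EqOn f g (strip ε) := by
  refine (hf.analyticOnNhd (isOpen_strip ε)).eqOn_of_preconnected_of_frequently_eq
    (hg.analyticOnNhd (isOpen_strip ε)) (convex_strip ε).isPreconnected
    (by simpa using ofReal_mem_strip hε 0) ?_
  have hreal : Tendsto ((↑) : ℝ → ℂ) (𝓝[≠] 0) (𝓝[≠] 0) := by
    simpa using continuous_ofReal.continuousWithinAt.tendsto_nhdsWithin
      (s := {0}ᶜ) (x := (0 : ℝ)) (t := {0}ᶜ) fun x hx => by simpa using hx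
  exact hreal.frequently (Frequently.of_forall h)

theorem differentiableOn_star_star (hf : DifferentiableOn ℂ f (strip ε)) :
    DifferentiableOn ℂ (fun z => star (f (star z))) (strip ε) := by
  intro z hz
  have h := (hf.differentiableAt ((isOpen_strip ε).mem_nhds (star_mem_strip hz))).star_star
  rw [star_star] at h
  exact h.differentiableWithinAt

/-- The Schwarz reflection principle. -/
theorem apply_star_of_forall_im_ofReal_eq_zero (hε : 0 < ε) (hf : DifferentiableOn ℂ f (strip ε))
    (h : ∀ x : ℝ, (f x).im = 0) (hz : z ∈ strip ε) : f (star z) = star (f z) := by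
  have hreal (x : ℝ) : star (f (star (x : ℂ))) = f x := by
    simpa using Complex.conj_eq_iff_im.2 (h x)
  rw [← eqOn_strip_of_forall_ofReal hε (differentiableOn_star_star hf) hf hreal hz, star_star]

namespace IsStripAnalytic

theorem continuous_comp_add_mul_I (hf : IsStripAnalytic ε f) {y : ℝ} (hy : |y| < ε) :
    Continuous fun x : ℝ => f (x + y * I) :=
  hf.1.continuousOn.comp_continuous (by fun_prop) fun x => by simpa [strip] using hy

theorem continuous_ofReal (hε : 0 < ε) (hf : IsStripAnalytic ε f) :
    Continuous fun x : ℝ => f x := by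
  simpa using hf.continuous_comp_add_mul_I (y := 0) (by simpa using hε)

theorem periodic_ofReal (hε : 0 < ε) (hf : IsStripAnalytic ε f) :
    Function.Periodic (fun x : ℝ => f x) 1 := fun x => by
  simpa using hf.2 x (ofReal_mem_strip hε x)

theorem mul (hf : IsStripAnalytic ε f) (hg : IsStripAnalytic ε g) :
    IsStripAnalytic ε fun z => f z * g z :=
  ⟨hf.1.mul hg.1, fun z hz => by simp only [hf.2 z hz, hg.2 z hz]⟩

theorem const_mul (c : ℂ) (hf : IsStripAnalytic ε f) : IsStripAnalytic ε fun z => c * f z :=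
  ⟨hf.1.const_mul c, fun z hz => by simp only [hf.2 z hz]⟩

theorem sum {ι : Type*} {F : ι → ℂ → ℂ} (s : Finset ι) (hF : ∀ i ∈ s, IsStripAnalytic ε (F i)) :
    IsStripAnalytic ε fun z => ∑ i ∈ s, F i z :=
  ⟨DifferentiableOn.fun_sum fun i hi => (hF i hi).1,
    fun z hz => Finset.sum_congr rfl fun i hi => (hF i hi).2 z hz⟩

theorem ex_comp (hf : IsStripAnalytic ε f) : IsStripAnalytic ε fun z => ex (f z) :=
  ⟨differentiable_ex.comp_differentiableOn hf.1, fun z hz => by simp only [hf.2 z hz]⟩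

theorem comp_add_ofReal (hf : IsStripAnalytic ε f) (a : ℝ) :
    IsStripAnalytic ε fun z => f (z + a) :=
  ⟨hf.1.comp (by fun_prop) fun z hz => add_ofReal_mem_strip hz a,
    fun z hz => by simpa only [add_right_comm] using hf.2 _ (add_ofReal_mem_strip hz a)⟩

theorem ex_int_mul (ε : ℝ) (k : ℤ) : IsStripAnalytic ε fun z => ex (k * z) :=
  ⟨(differentiable_ex.comp (by fun_prop)).differentiableOn,
    fun z _ => by simp only [mul_add, ex_add, mul_one, ex_intCast]⟩

end IsStripAnalytic

end Strip

section FourierCoefficients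

/-- The `k`-th Fourier coefficient of a function on `ℝ/ℤ`, given as a function on `ℝ`. An integral
over `[0, 1]` is used rather than `fourierCoeff` because the contour is moved into the complex
plane below. -/
def fCoeff (f : ℝ → ℂ) (k : ℤ) : ℂ := ∫ x in (0 : ℝ)..1, f x * ex (-(k * x))

theorem continuous_ex_neg_int_mul (k : ℤ) : Continuous fun x : ℝ => ex (-(k * x)) :=
  continuous_ex.comp (by fun_prop)

variable {f g : ℝ → ℂ}

theorem fCoeff_sub (hf : Continuous f) (hg : Continuous g) (k : ℤ) :
    fCoeff (fun x => f x - g x) k = fCoeff f k - fCoeff g k := by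
  simp only [fCoeff, sub_mul]
  exact intervalIntegral.integral_sub
    ((hf.mul (continuous_ex_neg_int_mul k)).intervalIntegrable _ _)
    ((hg.mul (continuous_ex_neg_int_mul k)).intervalIntegrable _ _)

theorem fCoeff_const_mul (c : ℂ) (f : ℝ → ℂ) (k : ℤ) :
    fCoeff (fun x => c * f x) k = c * fCoeff f k := by
  simp only [fCoeff, mul_assoc]
  exact intervalIntegral.integral_const_mul _ _

theorem fCoeff_sum {ι : Type*} (s : Finset ι) {F : ι → ℝ → ℂ} (hF : ∀ i ∈ s, Continuous (F i))
    (k : ℤ) : fCoeff (fun x => ∑ i ∈ s, F i x) k = ∑ i ∈ s, fCoeff (F i) k := by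
  simp only [fCoeff, Finset.sum_mul]
  exact intervalIntegral.integral_finsetSum fun i hi =>
    ((hF i hi).mul (continuous_ex_neg_int_mul k)).intervalIntegrable _ _

theorem norm_fCoeff_le {C : ℝ} (hf : ∀ x, ‖f x‖ ≤ C) (k : ℤ) : ‖fCoeff f k‖ ≤ C := by
  have hint (x : ℝ) : ‖f x * ex (-(k * x))‖ ≤ C := by
    rw [norm_mul, norm_ex_of_im_eq_zero (by simp), mul_one]
    exact hf x
  simpa [fCoeff] using
    intervalIntegral.norm_integral_le_of_norm_le_const (a := 0) (b := 1) fun x _ => hint x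

theorem fCoeff_ex_int_mul (f : ℝ → ℂ) (j k : ℤ) :
    fCoeff (fun x => ex (j * x) * f x) k = fCoeff f (k - j) := by
  refine intervalIntegral.integral_congr fun x _ => ?_
  have hex : ex (-(((k - j : ℤ) : ℂ) * x)) = ex (j * x) * ex (-(k * x)) := by
    rw [← ex_add]
    push_cast
    ring_nf
  simp only [hex]
  ring

theorem integral_ex_int_mul {k : ℤ} (hk : k ≠ 0) : ∫ x in (0 : ℝ)..1, ex (k * x) = 0 := by
  have hc : 2 * Real.pi * I * k ≠ 0 := by simp [hk, Real.pi_ne_zero]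
  simp only [ex, ← mul_assoc]
  rw [integral_exp_mul_complex hc, ofReal_one, mul_one, ← ex, ex_intCast]
  simp

theorem fCoeff_ex_int (j k : ℤ) : fCoeff (fun x => ex (j * x)) k = if k = j then 1 else 0 := by
  have hshift := fCoeff_ex_int_mul (fun _ => 1) j k
  simp only [mul_one] at hshift
  rw [hshift]
  split_ifs with hjk
  · simp [fCoeff, hjk, ex_zero]
  · simpa [fCoeff, ← neg_mul] using integral_ex_int_mul (k := j - k) (sub_ne_zero.2 (Ne.symm hjk))

theorem fCoeff_sum_mul_ex_int (s : Finset ℤ) (b : ℤ → ℂ) (k : ℤ) :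
    fCoeff (fun x => ∑ j ∈ s, b j * ex (j * x)) k = if k ∈ s then b k else 0 := by
  rw [fCoeff_sum s (F := fun j x => b j * ex (j * x)) fun j _ =>
    continuous_const.mul (continuous_ex.comp (by fun_prop))]
  simp only [fCoeff_const_mul, fCoeff_ex_int, mul_ite, mul_one, mul_zero, Finset.sum_ite_eq]

theorem fCoeff_comp_add (hf : Function.Periodic f 1) (a : ℝ) (k : ℤ) :
    fCoeff (fun x => f (x + a)) k = ex (k * a) * fCoeff f k := by
  set F : ℝ → ℂ := fun x => f x * ex (-(k * x)) with hF
  have hper : Function.Periodic F 1 := fun x => by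
    have hex : (-(k * ((x + 1 : ℝ) : ℂ))) = -(k * x) + ((-k : ℤ) : ℂ) := by push_cast; ring
    simp only [hF, hf x, hex, ex_add, ex_intCast, mul_one]
  have hshift (x : ℝ) : f (x + a) * ex (-(k * x)) = ex (k * a) * F (x + a) := by
    have hex : ex (-(k * x)) = ex (k * a) * ex (-(k * ((x + a : ℝ) : ℂ))) := by
      rw [← ex_add]
      push_cast
      ring_nf
    rw [hF, hex]
    ring
  simp only [fCoeff, hshift]
  rw [intervalIntegral.integral_const_mul, intervalIntegral.integral_comp_add_right F]
  simpa [add_comm] using congrArg (ex (k * a) * ·) (hper.intervalIntegral_add_eq a 0)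

theorem conj_ex (z : ℂ) : (starRingEnd ℂ) (ex z) = ex (-(starRingEnd ℂ) z) := by
  rw [ex, ex, ← Complex.exp_conj]
  congr 1
  simp [Complex.conj_ofNat]

theorem fCoeff_neg_of_im_eq_zero (hf : ∀ x, (f x).im = 0) (k : ℤ) :
    fCoeff f (-k) = star (fCoeff f k) := by
  simp only [fCoeff, Complex.star_def]
  rw [intervalIntegral.integral_of_le zero_le_one, intervalIntegral.integral_of_le zero_le_one,
    ← integral_conj]
  refine integral_congr_ae (.of_forall fun x => ?_)
  simp [conj_ex, Complex.conj_eq_iff_im.2 (hf x)]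

end FourierCoefficients

section ContourShift

variable {ε : ℝ} {f : ℂ → ℂ}

theorem integral_comp_add_mul_I (hf : IsStripAnalytic ε f) {y : ℝ} (hy : |y| < ε) :
    ∫ x in (0 : ℝ)..1, f (x + y * I) = ∫ x in (0 : ℝ)..1, f x := by
  have hmem {t : ℝ} (ht : t ∈ Set.uIcc 0 y) : |t| < ε := by
    simpa using (Set.abs_sub_left_of_mem_uIcc ht).trans_lt (by simpa using hy)
  have hrect : (Set.uIcc (0 : ℂ).re (1 + y * I).re ×ℂ Set.uIcc (0 : ℂ).im (1 + y * I).im)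
      ⊆ strip ε := fun z hz => hmem (by simpa using hz.2)
  have hboundary := Complex.integral_boundary_rect_eq_zero_of_differentiableOn f 0 (1 + y * I)
    (hf.1.mono hrect)
  have hsides : ∀ t ∈ Set.uIcc 0 y, f (1 + t * I) = f (t * I) := fun t ht => by
    rw [add_comm]
    exact hf.2 _ (by simpa [strip] using hmem ht)
  simp only [zero_re, add_re, one_re, mul_re, ofReal_re, I_re, mul_zero, ofReal_im, I_im, mul_one,
    sub_self, add_zero, zero_im, ofReal_zero, zero_mul, add_im, one_im, mul_im, zero_add,
    ofReal_one, intervalIntegral.integral_congr hsides] at hboundary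
  linear_combination -hboundary

theorem fCoeff_comp_add_mul_I (hf : IsStripAnalytic ε f) {y : ℝ} (hy : |y| < ε) (k : ℤ) :
    fCoeff (fun x => f (x + y * I)) k = ex (k * (y * I)) * fCoeff (fun x => f x) k := by
  have hshift := integral_comp_add_mul_I (hf.mul (.ex_int_mul ε (-k))) hy
  have hzero : ∫ x in (0 : ℝ)..1, f x * ex ((-k : ℤ) * x) = fCoeff (fun x => f x) k := by
    simp [fCoeff]
  rw [← hzero, ← hshift, ← intervalIntegral.integral_const_mul]
  refine intervalIntegral.integral_congr fun x _ => ?_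
  have hex : ex (-(k * x)) = ex (k * (y * I)) * ex ((-k : ℤ) * (x + y * I)) := by
    rw [← ex_add]
    push_cast
    ring_nf
  simp only [hex]
  ring

theorem norm_ex_int_mul_mul_I (k : ℤ) (y : ℝ) :
    ‖ex (k * (y * I))‖ = Real.exp (-(2 * Real.pi * y * k)) := by
  rw [norm_ex]
  simp
  ring_nf

theorem norm_fCoeff_le_of_norm_le (hf : IsStripAnalytic ε f) {y K : ℝ} (hy0 : 0 ≤ y)
    (hy : y < ε) (hK : ∀ z : ℂ, |z.im| ≤ y → ‖f z‖ ≤ K) (k : ℤ) :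
    ‖fCoeff (fun x => f x) k‖ ≤ K * Real.exp (-(2 * Real.pi * y * |(k : ℝ)|)) := by
  obtain ⟨t, ht, hkt⟩ : ∃ t : ℝ, |t| = y ∧ t * k = -(y * |(k : ℝ)|) := by
    rcases le_total 0 (k : ℝ) with hk | hk
    · exact ⟨-y, by rw [abs_neg, abs_of_nonneg hy0], by rw [abs_of_nonneg hk]; ring⟩
    · exact ⟨y, abs_of_nonneg hy0, by rw [abs_of_nonpos hk]; ring⟩
  have hshift : ‖fCoeff (fun x => f (x + t * I)) k‖ ≤ K :=
    norm_fCoeff_le (fun x => hK _ (by simp [ht])) k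
  rw [fCoeff_comp_add_mul_I hf (by rwa [ht]), norm_mul, norm_ex_int_mul_mul_I, mul_assoc, hkt,
    mul_neg, neg_neg, ← mul_assoc] at hshift
  rw [Real.exp_neg, ← div_eq_mul_inv, le_div_iff₀' (Real.exp_pos _)]
  exact hshift

theorem exp_abs_mul_one_sub_le {a t : ℝ} (ha : a ≤ |t|) :
    Real.exp |t| * (1 - Real.exp (-(2 * a))) ≤ |Real.exp (-t) - Real.exp t| := by
  have habs : |Real.exp (-t) - Real.exp t| = Real.exp |t| - Real.exp (-|t|) := by
    rcases le_total 0 t with ht | ht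
    · rw [abs_of_nonneg ht, abs_of_nonpos (by simpa using ht)]
      ring
    · rw [abs_of_nonpos ht, abs_of_nonneg (by simpa using ht), neg_neg]
  have hexp : Real.exp (-|t|) ≤ Real.exp |t| * Real.exp (-(2 * a)) := by
    rw [← Real.exp_add, Real.exp_le_exp]
    linarith
  rw [habs]
  linarith

/-- For a function which is real on the real axis, the difference of the values at `x + iy` and
`x - iy` only sees the imaginary part, and still controls every coefficient but the zeroth. -/
theorem norm_fCoeff_le_of_abs_im_le (hf : IsStripAnalytic ε f) (hreal : ∀ x : ℝ, (f x).im = 0)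
    {y Θ : ℝ} (hy0 : 0 < y) (hy : y < ε) (hΘ : ∀ z : ℂ, |z.im| ≤ y → |(f z).im| ≤ Θ) {k : ℤ}
    (hk : k ≠ 0) :
    ‖fCoeff (fun x => f x) k‖ ≤
      2 / (1 - Real.exp (-(4 * Real.pi * y))) * Θ * Real.exp (-(2 * Real.pi * y * |(k : ℝ)|)) := by
  have hyε : |y| < ε := by rwa [abs_of_pos hy0]
  have hnyε : |-y| < ε := by rwa [abs_neg]
  have hdiff (x : ℝ) : ‖f (x + y * I) - f (x + (-y : ℝ) * I)‖ ≤ 2 * Θ := by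
    have hz : ((x : ℂ) + y * I) ∈ strip ε := by simpa [strip] using hyε
    have hstar : (x : ℂ) + (-y : ℝ) * I = star ((x : ℂ) + y * I) := by
      apply Complex.ext <;> simp
    rw [hstar, apply_star_of_forall_im_ofReal_eq_zero (hy0.trans hy) hf.1 hreal hz,
      Complex.star_def, Complex.sub_conj]
    simpa using hΘ (x + y * I) (by simp [abs_of_pos hy0])
  have hcoeff := norm_fCoeff_le hdiff k
  rw [fCoeff_sub (hf.continuous_comp_add_mul_I hyε) (hf.continuous_comp_add_mul_I hnyε),
    fCoeff_comp_add_mul_I hf hyε, fCoeff_comp_add_mul_I hf hnyε, ← sub_mul, norm_mul] at hcoeff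
  set t := 2 * Real.pi * y * k with ht
  have habs : |t| = 2 * Real.pi * y * |(k : ℝ)| := by
    rw [ht, abs_mul, abs_of_pos (by positivity)]
  have hk1 : (1 : ℝ) ≤ |(k : ℝ)| := by exact_mod_cast Int.one_le_abs hk
  have hlower : Real.exp |t| * (1 - Real.exp (-(4 * Real.pi * y)))
      ≤ ‖ex (k * (y * I)) - ex (k * ((-y : ℝ) * I))‖ := by
    have hexp := exp_abs_mul_one_sub_le (a := 2 * Real.pi * y) (t := t)
      (by rw [habs]; exact le_mul_of_one_le_right (by positivity) hk1)
    refine le_trans (le_of_eq_of_le ?_ hexp) (le_of_eq_of_le ?_ (abs_norm_sub_norm_le _ _))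
    · ring_nf
    · rw [norm_ex_int_mul_mul_I, norm_ex_int_mul_mul_I, mul_neg, neg_mul, neg_neg]
  have hpos : 0 < 1 - Real.exp (-(4 * Real.pi * y)) := by
    rw [sub_pos, Real.exp_lt_one_iff, neg_lt_zero]
    positivity
  rw [← habs, Real.exp_neg |t|, div_mul_eq_mul_div, ← div_eq_mul_inv, div_div,
    le_div_iff₀' (by positivity), mul_comm (1 - _)]
  exact (mul_le_mul_of_nonneg_right hlower (norm_nonneg _)).trans hcoeff

end ContourShift

section FourierSeries

variable {f : ℝ → ℂ} {s Z : ℝ}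

theorem norm_le_tsum_norm_fCoeff (hf : Continuous f) (hper : Function.Periodic f 1)
    (hs : Summable fun k => ‖fCoeff f k‖) (x : ℝ) : ‖f x‖ ≤ ∑' k, ‖fCoeff f k‖ := by
  have : Fact (0 < (1 : ℝ)) := ⟨one_pos⟩
  let F : C(AddCircle (1 : ℝ), ℂ) := ⟨hper.lift, continuous_coinduced_dom.2 hf⟩
  have hF (x : ℝ) : F (x : AddCircle (1 : ℝ)) = f x := rfl
  have hcoeff (k : ℤ) : fourierCoeff F k = fCoeff f k := by
    rw [fourierCoeff_eq_intervalIntegral _ _ 0]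
    simp only [fCoeff, zero_add, div_one, one_smul]
    refine intervalIntegral.integral_congr fun t _ => ?_
    simp only [hF, fourier_coe_apply, smul_eq_mul, ex]
    rw [mul_comm]
    congr 2
    push_cast
    ring
  have hsum : Summable (fourierCoeff F) := .of_norm (by simpa only [hcoeff] using hs)
  have hseries := has_pointwise_sum_fourier_series_of_summable hsum (x : AddCircle (1 : ℝ))
  have hnorm (k : ℤ) : ‖fourierCoeff F k • fourier k (x : AddCircle (1 : ℝ))‖ = ‖fCoeff f k‖ := by
    rw [norm_smul, hcoeff, fourier_apply, Circle.norm_coe, mul_one]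
  rw [← hF x, ← hseries.tsum_eq]
  exact (norm_tsum_le_tsum_norm (by simpa only [hnorm] using hs)).trans_eq (by simp only [hnorm])

theorem summable_exp_neg_mul_abs (hs : 0 < s) :
    Summable fun k : ℤ => Real.exp (-(s * |(k : ℝ)|)) := by
  have hnat : Summable fun n : ℕ => Real.exp (-(s * n)) := by
    simpa [mul_comm] using (Real.summable_exp_nat_mul_iff (a := -s)).2 (neg_neg_of_pos hs)
  exact .of_nat_of_neg (by simpa using hnat) (by simpa using hnat)

/-- The mass `∑_k e^{-s|k|}` of a geometric weight on `ℤ`. -/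
def expMass (s : ℝ) : ℝ := ∑' k : ℤ, Real.exp (-(s * |(k : ℝ)|))

theorem expMass_nonneg (s : ℝ) : 0 ≤ expMass s := tsum_nonneg fun _ => (Real.exp_pos _).le

theorem norm_le_mul_expMass (hf : Continuous f) (hper : Function.Periodic f 1) (hs : 0 < s)
    (hdecay : ∀ k : ℤ, ‖fCoeff f k‖ ≤ Z * Real.exp (-(s * |(k : ℝ)|))) (x : ℝ) :
    ‖f x‖ ≤ Z * expMass s := by
  have hmajor := (summable_exp_neg_mul_abs hs).mul_left Z
  have hsum := Summable.of_nonneg_of_le (fun _ => norm_nonneg _) hdecay hmajor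
  calc ‖f x‖ ≤ ∑' k, ‖fCoeff f k‖ := norm_le_tsum_norm_fCoeff hf hper hsum x
    _ ≤ ∑' k : ℤ, Z * Real.exp (-(s * |(k : ℝ)|)) := hsum.tsum_le_tsum hdecay hmajor
    _ = Z * expMass s := tsum_mul_left

theorem norm_sub_sum_fCoeff_le (hf : Continuous f) (hper : Function.Periodic f 1) (hs : 0 < s)
    (hZ : 0 ≤ Z) {t : ℝ} (ht : 0 ≤ t) {M : ℕ}
    (hdecay : ∀ k : ℤ, (M : ℤ) < |k| → ‖fCoeff f k‖ ≤ Z * Real.exp (-((s + t) * |(k : ℝ)|)))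
    (x : ℝ) :
    ‖f x - ∑ k ∈ Finset.Icc (-(M : ℤ)) M, fCoeff f k * ex (k * x)‖
      ≤ Z * Real.exp (-(t * M)) * expMass s := by
  set T : ℝ → ℂ := fun x => ∑ k ∈ Finset.Icc (-(M : ℤ)) M, fCoeff f k * ex (k * x)
  have hTcont : Continuous T := continuous_finsetSum _ fun k _ =>
    continuous_const.mul (continuous_ex.comp (by fun_prop))
  have hTper : Function.Periodic T 1 := fun x => Finset.sum_congr rfl fun k _ => by
    push_cast
    rw [mul_add, ex_add, mul_one, ex_intCast, mul_one]
  refine norm_le_mul_expMass (hf.sub hTcont) (hper.sub hTper) hs (fun k => ?_) x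
  rw [Pi.sub_def, fCoeff_sub hf hTcont, fCoeff_sum_mul_ex_int]
  split_ifs with hk
  · rw [sub_self, norm_zero]
    positivity
  · rw [Finset.mem_Icc, ← abs_le, not_le] at hk
    have hMk : (M : ℝ) ≤ |(k : ℝ)| := by exact_mod_cast hk.le
    rw [sub_zero, mul_assoc, ← Real.exp_add]
    refine (hdecay k hk).trans ?_
    gcongr
    nlinarith

end FourierSeries

section SmallDivisors

variable {e a : ℂ} {N : ℕ} {X : ℝ}

theorem half_le_re_of_norm_sub_one_le_one {w : ℂ} (hw : ‖w‖ = 1) (h : ‖w - 1‖ ≤ 1) :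
    1 / 2 ≤ w.re := by
  have hw2 : ‖w‖ ^ 2 = 1 := by rw [hw, one_pow]
  have h2 : ‖w - 1‖ ^ 2 ≤ 1 := pow_le_one₀ (norm_nonneg _) h
  simp only [Complex.sq_norm, normSq_apply, sub_re, one_re, sub_im, one_im, sub_zero] at hw2 h2
  nlinarith

theorem half_mul_norm_sub_one_le (he : ‖e‖ = 1) (h : ∀ j ≤ N, ‖e ^ j - 1‖ ≤ 1) :
    N * ‖e - 1‖ / 2 ≤ ‖e ^ N - 1‖ := by
  have hgeom : (N : ℝ) / 2 ≤ ‖∑ i ∈ Finset.range N, e ^ i‖ := by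
    calc (N : ℝ) / 2 = ∑ _i ∈ Finset.range N, (1 / 2 : ℝ) := by simp [div_eq_mul_inv]
      _ ≤ ∑ i ∈ Finset.range N, (e ^ i).re := Finset.sum_le_sum fun i hi =>
          half_le_re_of_norm_sub_one_le_one (by rw [norm_pow, he, one_pow])
            (h i (Finset.mem_range.1 hi).le)
      _ ≤ ‖∑ i ∈ Finset.range N, e ^ i‖ := by
          rw [← Complex.re_sum]
          exact Complex.re_le_norm _
  rw [← geom_sum_mul, norm_mul, mul_div_right_comm]
  exact mul_le_mul_of_nonneg_right hgeom (norm_nonneg _)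

/-- Either some `e ^ j` is far from `1`, and then `a / (e - 1)` is a bounded multiple of a partial
sum, or all of them are close to `1`, and then the last partial sum grows like `N`. -/
theorem norm_div_sub_one_mul_min_le (he : ‖e‖ = 1)
    (h : ∀ j ≤ N, ‖a‖ * ‖∑ i ∈ Finset.range j, e ^ i‖ ≤ X) :
    ‖a / (e - 1)‖ * min 1 (N * ‖e - 1‖ / 2) ≤ X := by
  have hquot {j : ℕ} (hj : j ≤ N) : ‖a / (e - 1)‖ * ‖e ^ j - 1‖ ≤ X := by
    refine le_trans ?_ (h j hj)
    rcases eq_or_ne e 1 with rfl | he1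
    · simp only [one_pow, sub_self, norm_zero, mul_zero]
      positivity
    · have hpos : 0 < ‖e - 1‖ := norm_pos_iff.2 (sub_ne_zero.2 he1)
      rw [← geom_sum_mul, norm_mul, norm_div]
      exact le_of_eq (by field_simp)
  by_cases hclose : ∀ j ≤ N, ‖e ^ j - 1‖ ≤ 1
  · refine le_trans ?_ (hquot le_rfl)
    gcongr
    exact (min_le_right _ _).trans (half_mul_norm_sub_one_le he hclose)
  · push Not at hclose
    obtain ⟨j, hj, hfar⟩ := hclose
    refine le_trans ?_ (hquot hj)
    gcongr
    exact (min_le_left _ _).trans hfar.le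

end SmallDivisors

section CohomologicalEquation

/-- The Birkhoff sums of `ρ` over the rotation by `ω` up to time `N` have imaginary part at most
`Θ` on the closed strip `|Im z| ≤ y`. -/
def BirkhoffImBound (ρ : ℂ → ℂ) (ω y Θ : ℝ) (N : ℕ) : Prop :=
  ∀ j ≤ N, ∀ z : ℂ, |z.im| ≤ y → |(∑ i ∈ Finset.range j, ρ (z + (i * ω : ℝ))).im| ≤ Θ

/-- Arithmetic input on the rotation number: the divisors `e(kω) - 1` are at least `γ` for
`0 < |k| ≤ K₀` and at least `1 / Q` for `0 < |k| ≤ Q / 2`. -/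
structure NonResonant (ω γ Q : ℝ) (K₀ : ℕ) : Prop where
  low : ∀ k : ℤ, k ≠ 0 → |k| ≤ K₀ → γ ≤ ‖ex (k * ω) - 1‖
  high : ∀ k : ℤ, k ≠ 0 → 2 * |(k : ℝ)| ≤ Q → 1 / Q ≤ ‖ex (k * ω) - 1‖

/-- The `k`-th Fourier coefficient of the formal solution `g` of `g(· + ω) - g = ρ - ρ̂(0)`. It
vanishes for `k = 0`, because the division is then a division by zero. -/
def cobCoeff (ρ : ℂ → ℂ) (ω : ℝ) (k : ℤ) : ℂ := fCoeff (fun x => ρ x) k / (ex (k * ω) - 1)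

/-- The truncation to frequencies `|k| ≤ M` of the formal solution of the cohomological equation
`g(· + ω) - g = ρ - ρ̂(0)`. -/
def gauge (ρ : ℂ → ℂ) (ω : ℝ) (M : ℕ) (z : ℂ) : ℂ :=
  ∑ k ∈ Finset.Icc (-(M : ℤ)) M, cobCoeff ρ ω k * ex (k * z)

/-- The constant by which bounds on the imaginary part of Birkhoff sums on the strip
`|Im z| ≤ 2s/π` bound the Fourier coefficients. -/
def decayConst (s : ℝ) : ℝ := 2 / (1 - Real.exp (-(8 * s)))

/-- The constant by which bounds on the imaginary part of Birkhoff sums on the strip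
`|Im z| ≤ 2s/π` bound the gauge function on the strip `|Im z| ≤ s/π`. -/
def gaugeConst (s : ℝ) : ℝ := decayConst s * expMass s

variable {ε s Θ ω γ Q κ : ℝ} {ρ : ℂ → ℂ} {N M K₀ : ℕ}

theorem decayConst_pos (hs : 0 < s) : 0 < decayConst s := by
  refine div_pos two_pos ?_
  rw [sub_pos, Real.exp_lt_one_iff]
  linarith

theorem gaugeConst_nonneg (hs : 0 < s) : 0 ≤ gaugeConst s :=
  mul_nonneg (decayConst_pos hs).le (expMass_nonneg s)

theorem BirkhoffImBound.nonneg (hs : 0 < s) (hΘ : BirkhoffImBound ρ ω (2 * s / Real.pi) Θ N) :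
    0 ≤ Θ :=
  (abs_nonneg _).trans <| hΘ 0 (Nat.zero_le _) 0 <| by
    rw [zero_im, abs_zero]
    positivity

theorem fCoeff_birkhoffSum (hε : 0 < ε) (hρ : IsStripAnalytic ε ρ) (ω : ℝ) (j : ℕ) (k : ℤ) :
    fCoeff (fun x : ℝ => ∑ i ∈ Finset.range j, ρ (x + (i * ω : ℝ))) k
      = fCoeff (fun x => ρ x) k * ∑ i ∈ Finset.range j, ex (k * ω) ^ i := by
  rw [fCoeff_sum _ fun i _ => (hρ.comp_add_ofReal _).continuous_ofReal hε, Finset.mul_sum]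
  refine Finset.sum_congr rfl fun i _ => ?_
  have hshift := fCoeff_comp_add (hρ.periodic_ofReal hε) (i * ω) k
  simp only [ofReal_add] at hshift
  rw [hshift, mul_comm, ← ex_natCast_mul]
  push_cast
  ring_nf

theorem norm_fCoeff_mul_norm_geom_sum_le (hs : 0 < s) (hsε : 2 * s / Real.pi < ε)
    (hρ : IsStripAnalytic ε ρ) (hreal : ∀ x : ℝ, (ρ x).im = 0)
    (hΘ : BirkhoffImBound ρ ω (2 * s / Real.pi) Θ N) {j : ℕ} (hj : j ≤ N) {k : ℤ} (hk : k ≠ 0) :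
    ‖fCoeff (fun x => ρ x) k‖ * ‖∑ i ∈ Finset.range j, ex (k * ω) ^ i‖
      ≤ decayConst s * Θ * Real.exp (-(4 * s * |(k : ℝ)|)) := by
  have hy : 0 < 2 * s / Real.pi := by positivity
  have hsum : IsStripAnalytic ε fun z => ∑ i ∈ Finset.range j, ρ (z + (i * ω : ℝ)) :=
    .sum _ fun i _ => hρ.comp_add_ofReal _
  have hsumreal (x : ℝ) : (∑ i ∈ Finset.range j, ρ (x + (i * ω : ℝ))).im = 0 := by
    rw [Complex.im_sum]
    exact Finset.sum_eq_zero fun i _ => by rw [← ofReal_add, hreal]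
  rw [← norm_mul, ← fCoeff_birkhoffSum (hy.trans hsε) hρ]
  have hwidth : Real.pi * (2 * s / Real.pi) = 2 * s := mul_div_cancel₀ _ Real.pi_ne_zero
  have hdecay := norm_fCoeff_le_of_abs_im_le hsum hsumreal hy hsε (hΘ j hj) hk
  rw [mul_assoc 4, mul_assoc 2 Real.pi, hwidth] at hdecay
  exact hdecay.trans_eq (by rw [decayConst]; ring_nf)

theorem norm_fCoeff_le_decayConst_mul (hs : 0 < s) (hsε : 2 * s / Real.pi < ε)
    (hρ : IsStripAnalytic ε ρ) (hreal : ∀ x : ℝ, (ρ x).im = 0)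
    (hΘ : BirkhoffImBound ρ ω (2 * s / Real.pi) Θ N) (hN : 0 < N) {k : ℤ} (hk : k ≠ 0) :
    ‖fCoeff (fun x => ρ x) k‖ ≤ decayConst s * Θ * Real.exp (-(4 * s * |(k : ℝ)|)) := by
  simpa using norm_fCoeff_mul_norm_geom_sum_le hs hsε hρ hreal hΘ (j := 1) hN hk

theorem NonResonant.exp_neg_le_min (hω : NonResonant ω γ Q K₀) (hs : 0 ≤ s) (hκ : 0 < κ)
    (hQ : 0 < Q) (hN : κ * Q ≤ N) (hγ : 2 ≤ N * γ) (hK₀ : 2 / κ * Real.exp (-(s * K₀)) ≤ 1)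
    {k : ℤ} (hk : k ≠ 0) (hkQ : 2 * |(k : ℝ)| ≤ Q) :
    Real.exp (-(s * |(k : ℝ)|)) ≤ min 1 (N * ‖ex (k * ω) - 1‖ / 2) := by
  have hexp : Real.exp (-(s * |(k : ℝ)|)) ≤ 1 :=
    Real.exp_le_one_iff.2 (neg_nonpos.2 (by positivity))
  refine le_min hexp ?_
  rcases le_or_gt |k| K₀ with hlow | hhigh
  · have := mul_le_mul_of_nonneg_left (hω.low k hk hlow) (Nat.cast_nonneg N)
    linarith
  · have hkK₀ : (K₀ : ℝ) ≤ |(k : ℝ)| := by exact_mod_cast hhigh.le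
    have hκN : κ ≤ N * ‖ex (k * ω) - 1‖ := calc
      κ = κ * Q * (1 / Q) := by field_simp
      _ ≤ N * ‖ex (k * ω) - 1‖ := mul_le_mul hN (hω.high k hk hkQ) (by positivity) (by positivity)
    calc Real.exp (-(s * |(k : ℝ)|)) ≤ Real.exp (-(s * K₀)) := by gcongr
      _ = κ / 2 * (2 / κ * Real.exp (-(s * K₀))) := by field_simp
      _ ≤ κ / 2 * 1 := by gcongr
      _ ≤ N * ‖ex (k * ω) - 1‖ / 2 := by linarith

theorem norm_cobCoeff_le (hs : 0 < s) (hsε : 2 * s / Real.pi < ε)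
    (hρ : IsStripAnalytic ε ρ) (hreal : ∀ x : ℝ, (ρ x).im = 0)
    (hΘ : BirkhoffImBound ρ ω (2 * s / Real.pi) Θ N) (hω : NonResonant ω γ Q K₀) (hκ : 0 < κ)
    (hQ : 0 < Q) (hN : κ * Q ≤ N) (hγ : 2 ≤ N * γ) (hK₀ : 2 / κ * Real.exp (-(s * K₀)) ≤ 1)
    {k : ℤ} (hkQ : 2 * |(k : ℝ)| ≤ Q) :
    ‖cobCoeff ρ ω k‖ ≤ decayConst s * Θ * Real.exp (-(3 * s * |(k : ℝ)|)) := by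
  have hΘ0 := hΘ.nonneg hs
  rcases eq_or_ne k 0 with rfl | hk
  · have := (decayConst_pos hs).le
    simp only [cobCoeff, Int.cast_zero, zero_mul, ex_zero, sub_self, div_zero, norm_zero]
    positivity
  have hdiv := norm_div_sub_one_mul_min_le (norm_ex_of_im_eq_zero (z := k * ω) (by simp))
    fun j hj => norm_fCoeff_mul_norm_geom_sum_le hs hsε hρ hreal hΘ hj hk
  have hmin := hω.exp_neg_le_min hs.le hκ hQ hN hγ hK₀ hk hkQ
  have hsplit : Real.exp (-(4 * s * |(k : ℝ)|))
      = Real.exp (-(3 * s * |(k : ℝ)|)) * Real.exp (-(s * |(k : ℝ)|)) := by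
    rw [← Real.exp_add]
    ring_nf
  rw [hsplit, ← mul_assoc] at hdiv
  exact le_of_mul_le_mul_right
    ((mul_le_mul_of_nonneg_left hmin (norm_nonneg _)).trans hdiv) (Real.exp_pos _)

theorem cobCoeff_neg (hreal : ∀ x : ℝ, (ρ x).im = 0) (ω : ℝ) (k : ℤ) :
    cobCoeff ρ ω (-k) = star (cobCoeff ρ ω k) := by
  rw [cobCoeff, cobCoeff, fCoeff_neg_of_im_eq_zero hreal, Complex.star_def, map_div₀, map_sub,
    map_one, conj_ex]
  simp

theorem gauge_ofReal_im (hreal : ∀ x : ℝ, (ρ x).im = 0) (ω : ℝ) (M : ℕ) (x : ℝ) :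
    (gauge ρ ω M x).im = 0 := by
  rw [← Complex.conj_eq_iff_im, gauge, map_sum]
  refine Finset.sum_nbij' (fun k => -k) (fun k => -k) ?_ ?_ (by simp) (by simp) fun k _ => ?_
  · intro k hk
    simp only [Finset.mem_Icc] at hk ⊢
    omega
  · intro k hk
    simp only [Finset.mem_Icc] at hk ⊢
    omega
  · simp [cobCoeff_neg hreal, conj_ex]

theorem isStripAnalytic_gauge (ε : ℝ) (ρ : ℂ → ℂ) (ω : ℝ) (M : ℕ) :
    IsStripAnalytic ε (gauge ρ ω M) :=
  .sum _ fun k _ => (IsStripAnalytic.ex_int_mul ε k).const_mul _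

theorem norm_sum_mul_ex_int_le {S : Finset ℤ} {b : ℤ → ℂ} {Z : ℝ} (hs : 0 < s) (hZ : 0 ≤ Z)
    (hb : ∀ k ∈ S, ‖b k‖ ≤ Z * Real.exp (-(3 * s * |(k : ℝ)|))) {z : ℂ}
    (hz : |z.im| ≤ s / Real.pi) : ‖∑ k ∈ S, b k * ex (k * z)‖ ≤ Z * expMass s := by
  have hterm : ∀ k ∈ S, ‖b k * ex (k * z)‖ ≤ Z * Real.exp (-(s * |(k : ℝ)|)) := fun k hk => by
    have him : -(2 * Real.pi * (k * z).im) ≤ 2 * s * |(k : ℝ)| := calc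
      -(2 * Real.pi * (k * z).im) ≤ |2 * Real.pi * (k * z).im| := neg_le_abs _
      _ = 2 * Real.pi * (|(k : ℝ)| * |z.im|) := by simp [abs_mul, abs_of_pos Real.pi_pos]
      _ ≤ 2 * Real.pi * (|(k : ℝ)| * (s / Real.pi)) := by gcongr
      _ = 2 * s * |(k : ℝ)| := by field_simp
    calc ‖b k * ex (k * z)‖
        ≤ Z * Real.exp (-(3 * s * |(k : ℝ)|)) * Real.exp (2 * s * |(k : ℝ)|) := by
          rw [norm_mul, norm_ex]
          gcongr
          exact hb k hk
      _ = Z * Real.exp (-(s * |(k : ℝ)|)) := by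
          rw [mul_assoc, ← Real.exp_add]
          ring_nf
  calc ‖∑ k ∈ S, b k * ex (k * z)‖ ≤ ∑ k ∈ S, Z * Real.exp (-(s * |(k : ℝ)|)) :=
        norm_sum_le_of_le S hterm
    _ = Z * ∑ k ∈ S, Real.exp (-(s * |(k : ℝ)|)) := by rw [Finset.mul_sum]
    _ ≤ Z * expMass s := by
        gcongr
        exact (summable_exp_neg_mul_abs hs).sum_le_tsum S fun _ _ => (Real.exp_pos _).le

theorem norm_gauge_le (hs : 0 < s) (hsε : 2 * s / Real.pi < ε)
    (hρ : IsStripAnalytic ε ρ) (hreal : ∀ x : ℝ, (ρ x).im = 0)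
    (hΘ : BirkhoffImBound ρ ω (2 * s / Real.pi) Θ N) (hω : NonResonant ω γ Q K₀) (hκ : 0 < κ)
    (hQ : 0 < Q) (hN : κ * Q ≤ N) (hγ : 2 ≤ N * γ) (hK₀ : 2 / κ * Real.exp (-(s * K₀)) ≤ 1)
    (hM : 2 * M ≤ Q) {z : ℂ} (hz : |z.im| ≤ s / Real.pi) :
    ‖gauge ρ ω M z‖ ≤ gaugeConst s * Θ := by
  refine (norm_sum_mul_ex_int_le hs (mul_nonneg (decayConst_pos hs).le (hΘ.nonneg hs))
    (fun k hk => norm_cobCoeff_le hs hsε hρ hreal hΘ hω hκ hQ hN hγ hK₀ ?_) hz).trans_eq ?_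
  · have hkM : |(k : ℝ)| ≤ M := by exact_mod_cast abs_le.2 (Finset.mem_Icc.1 hk)
    linarith
  · rw [gaugeConst]
    ring

theorem fCoeff_zero_add_gauge_sub
    (hne : ∀ k : ℤ, k ≠ 0 → |k| ≤ M → ex (k * ω) ≠ 1) (z : ℂ) :
    fCoeff (fun x => ρ x) 0 + (gauge ρ ω M (z + ω) - gauge ρ ω M z)
      = ∑ k ∈ Finset.Icc (-(M : ℤ)) M, fCoeff (fun x => ρ x) k * ex (k * z) := by
  have hzero : fCoeff (fun x => ρ x) 0
      = ∑ k ∈ Finset.Icc (-(M : ℤ)) M, if k = 0 then fCoeff (fun x => ρ x) 0 else 0 := by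
    rw [Finset.sum_ite_eq' _ 0, if_pos (by simp)]
  rw [hzero, gauge, gauge, ← Finset.sum_sub_distrib, ← Finset.sum_add_distrib]
  refine Finset.sum_congr rfl fun k hk => ?_
  rcases eq_or_ne k 0 with rfl | hk0
  · simp [ex_zero]
  · have hdiv := sub_ne_zero.2 (hne k hk0 (abs_le.2 (Finset.mem_Icc.1 hk)))
    rw [if_neg hk0, cobCoeff, mul_add, ex_add]
    field_simp
    ring

theorem NonResonant.ex_ne_one (hω : NonResonant ω γ Q K₀) (hQ : 0 < Q) {k : ℤ} (hk : k ≠ 0)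
    (hkQ : 2 * |(k : ℝ)| ≤ Q) : ex (k * ω) ≠ 1 := fun h => by
  have hhigh := hω.high k hk hkQ
  rw [h, sub_self, norm_zero] at hhigh
  exact absurd hhigh (not_le.2 (by positivity))

theorem norm_sub_fCoeff_zero_sub_gauge_sub_le (hs : 0 < s) (hsε : 2 * s / Real.pi < ε)
    (hρ : IsStripAnalytic ε ρ) (hreal : ∀ x : ℝ, (ρ x).im = 0)
    (hΘ : BirkhoffImBound ρ ω (2 * s / Real.pi) Θ N) (hN : 0 < N) (hω : NonResonant ω γ Q K₀)
    (hQ : 0 < Q) (hM : 2 * M ≤ Q) (x : ℝ) :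
    ‖ρ x - (fCoeff (fun x => ρ x) 0 + (gauge ρ ω M (x + ω) - gauge ρ ω M x))‖
      ≤ gaugeConst s * Θ * Real.exp (-(3 * s * M)) := by
  have hε : 0 < ε := lt_trans (by positivity) hsε
  have hne (k : ℤ) (hk : k ≠ 0) (hkM : |k| ≤ M) : ex (k * ω) ≠ 1 := by
    have hkM' : |(k : ℝ)| ≤ M := by exact_mod_cast hkM
    exact hω.ex_ne_one hQ hk (by linarith)
  rw [fCoeff_zero_add_gauge_sub hne]
  refine (norm_sub_sum_fCoeff_le (hρ.continuous_ofReal hε) (hρ.periodic_ofReal hε) hs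
    (mul_nonneg (decayConst_pos hs).le (hΘ.nonneg hs)) (by positivity : 0 ≤ 3 * s) (fun k hk => ?_)
    x).trans_eq ?_
  · rw [show s + 3 * s = 4 * s by ring]
    refine norm_fCoeff_le_decayConst_mul hs hsε hρ hreal hΘ hN ?_
    rintro rfl
    simp only [abs_zero] at hk
    omega
  · rw [gaugeConst]
    ring

end CohomologicalEquation

section SmallVectors

theorem norm_dotProduct_le_card_mul {ι : Type*} [Fintype ι] {a : ι → ℂ} {C : ℝ}
    (ha : ∀ i, ‖a i‖ ≤ C) (x : ι → ℂ) : ‖a ⬝ᵥ x‖ ≤ Fintype.card ι * C * ‖x‖ := by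
  calc ‖a ⬝ᵥ x‖ ≤ ∑ _i : ι, C * ‖x‖ := norm_sum_le_of_le _ fun i _ => by
        rw [norm_mul]
        exact mul_le_mul (ha i) (norm_le_pi_norm x i) (norm_nonneg _)
          ((norm_nonneg _).trans (ha i))
    _ = Fintype.card ι * C * ‖x‖ := by
        rw [Finset.sum_const, Finset.card_univ, nsmul_eq_mul, mul_assoc]

theorem norm_mulVec_le_card_mul {ι κ : Type*} [Fintype ι] [Fintype κ] {A : Matrix ι κ ℂ} {C : ℝ}
    (hC : 0 ≤ C) (hA : ∀ i j, ‖A i j‖ ≤ C) (x : κ → ℂ) :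
    ‖A.mulVec x‖ ≤ Fintype.card κ * C * ‖x‖ :=
  (pi_norm_le_iff_of_nonneg (by positivity)).2 fun i => norm_dotProduct_le_card_mul (hA i) x

/-- Take the vector orthogonal to a row which is not small, or a basis vector if there is none. -/
theorem exists_norm_eq_one_norm_mulVec_le {A : Matrix (Fin 2) (Fin 2) ℂ} {X : ℝ} (hX : 0 ≤ X)
    (hdet : ‖A.det‖ ≤ X ^ 2) : ∃ ξ : Fin 2 → ℂ, ‖ξ‖ = 1 ∧ ‖A.mulVec ξ‖ ≤ X := by
  by_cases hcol : ∀ i, ‖A i 0‖ ≤ X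
  · refine ⟨Pi.single 0 1, by simp [Pi.norm_single], ?_⟩
    rw [Matrix.mulVec_single_one]
    exact (pi_norm_le_iff_of_nonneg hX).2 hcol
  · push Not at hcol
    obtain ⟨i, hi⟩ := hcol
    set w : Fin 2 → ℂ := ![A i 1, -A i 0]
    have hXw : X < ‖w‖ := hi.trans_le (by simpa [w] using norm_le_pi_norm w 1)
    have hw : 0 < ‖w‖ := hX.trans_lt hXw
    have hAw : ‖A.mulVec w‖ ≤ ‖A.det‖ := by
      refine (pi_norm_le_iff_of_nonneg (norm_nonneg _)).2 fun k => ?_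
      have hk : (A.mulVec w) k = 0 ∨ (A.mulVec w) k = A.det ∨ (A.mulVec w) k = -A.det := by
        fin_cases i <;> fin_cases k <;>
          simp [w, Matrix.mulVec, dotProduct, Fin.sum_univ_two, Matrix.det_fin_two] <;> grind
      rcases hk with hk | hk | hk <;> simp [hk]
    refine ⟨((‖w‖⁻¹ : ℝ) : ℂ) • w, ?_, ?_⟩
    · rw [norm_smul, norm_real, norm_inv, norm_norm, inv_mul_cancel₀ hw.ne']
    · rw [Matrix.mulVec_smul, norm_smul, norm_real, norm_inv, norm_norm, inv_mul_le_iff₀ hw]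
      nlinarith

end SmallVectors

section DifferenceEquation

/-- The operator `ψ ↦ ψ(m + 1) + ψ(m - 1) - c(m) ψ(m)` of a second order difference equation. -/
def discreteSchrodinger (c ψ : ℤ → ℂ) (m : ℤ) : ℂ := ψ (m + 1) + ψ (m - 1) - c m * ψ m

/-- The Wronskian of two sequences, which is constant if both are annihilated by the same
operator `discreteSchrodinger c`. -/
def wronskian (f h : ℤ → ℂ) (m : ℤ) : ℂ := f (m + 1) * h m - f m * h (m + 1)

variable {c f h ψ : ℤ → ℂ} {C K X η s t : ℝ}

theorem wronskian_sub_wronskian (c f h : ℤ → ℂ) (m : ℤ) :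
    wronskian f h m - wronskian f h (m - 1)
      = discreteSchrodinger c f m * h m - f m * discreteSchrodinger c h m := by
  simp only [wronskian, discreteSchrodinger, sub_add_cancel]
  ring

theorem norm_wronskian_zero_le (hf : ∀ m, ‖discreteSchrodinger c f m‖ ≤ η)
    (hh : ∀ m, ‖discreteSchrodinger c h m‖ ≤ η) (hfK : ∀ m, ‖f m‖ ≤ K) (hhK : ∀ m, ‖h m‖ ≤ K)
    (n : ℕ) : ‖wronskian f h 0‖ ≤ ‖wronskian f h n‖ + n * (2 * K * η) := by
  have hη : 0 ≤ η := (norm_nonneg _).trans (hf 0)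
  have hK : 0 ≤ K := (norm_nonneg _).trans (hfK 0)
  induction n with
  | zero => simp
  | succ n ih =>
    have hstep : ‖wronskian f h (n + 1) - wronskian f h n‖ ≤ 2 * K * η := by
      have hdiff := wronskian_sub_wronskian c f h (n + 1)
      rw [add_sub_cancel_right] at hdiff
      rw [hdiff]
      calc _ ≤ η * K + K * η := (norm_sub_le _ _).trans <| by
            rw [norm_mul, norm_mul]
            gcongr <;> simp only [hf, hh, hfK, hhK]
        _ = 2 * K * η := by ring
    have htri := norm_sub_norm_le (wronskian f h n) (wronskian f h (n + 1))
    rw [norm_sub_rev] at htri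
    push_cast
    linarith

theorem norm_wronskian_zero_le_of_decay (hK : 0 ≤ K) (hs : 0 ≤ s)
    (hf : ∀ m, ‖discreteSchrodinger c f m‖ ≤ η) (hh : ∀ m, ‖discreteSchrodinger c h m‖ ≤ η)
    (hfK : ∀ m : ℤ, ‖f m‖ ≤ K * Real.exp (-(2 * s * |(m : ℝ)|)))
    (hhK : ∀ m : ℤ, ‖h m‖ ≤ K * Real.exp (-(2 * s * |(m : ℝ)|))) (n : ℕ) :
    ‖wronskian f h 0‖ ≤ 2 * K ^ 2 * Real.exp (-(2 * s * n)) + n * (2 * K * η) := by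
  have hle (m : ℤ) : K * Real.exp (-(2 * s * |(m : ℝ)|)) ≤ K :=
    mul_le_of_le_one_right hK (Real.exp_le_one_iff.2 (neg_nonpos.2 (by positivity)))
  have hfn := hfK n
  have hhn := hhK n
  simp only [Int.cast_natCast, Nat.abs_cast] at hfn hhn
  refine (norm_wronskian_zero_le hf hh (fun m => (hfK m).trans (hle m))
    (fun m => (hhK m).trans (hle m)) n).trans ?_
  gcongr
  calc ‖wronskian f h n‖
      ≤ K * (K * Real.exp (-(2 * s * n))) + K * Real.exp (-(2 * s * n)) * K := by
        refine (norm_sub_le _ _).trans ?_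
        rw [norm_mul, norm_mul]
        gcongr
        · exact (hfK _).trans (hle _)
        · exact (hhK _).trans (hle _)
    _ = 2 * K ^ 2 * Real.exp (-(2 * s * n)) := by ring

theorem le_pow_mul_of_recurrence {u : ℕ → ℝ} (hC : 0 ≤ C) (hX : 0 ≤ X) (h0 : u 0 ≤ X)
    (h1 : u 1 ≤ X) (hrec : ∀ n, u (n + 2) ≤ C * u (n + 1) + u n + X) (n : ℕ) :
    u n ≤ (C + 2) ^ n * X := by
  have hC1 : 1 ≤ C + 2 := by linarith
  induction n using Nat.twoStepInduction with
  | zero => simpa using h0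
  | one => exact h1.trans (le_mul_of_one_le_left hX (by simpa using hC1))
  | more n ih ih' =>
    have hone : 1 ≤ (C + 2) ^ (n + 1) := one_le_pow₀ hC1
    have hmono : (C + 2) ^ n ≤ (C + 2) ^ (n + 1) := pow_le_pow_right₀ hC1 n.le_succ
    calc u (n + 2) ≤ C * u (n + 1) + u n + X := hrec n
      _ ≤ C * ((C + 2) ^ (n + 1) * X) + (C + 2) ^ (n + 1) * X + (C + 2) ^ (n + 1) * X := by
          gcongr
          · exact ih.trans (by gcongr)
          · exact le_mul_of_one_le_left hX hone
      _ = (C + 2) ^ (n + 2) * X := by ring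

theorem norm_natCast_le_pow_mul (hC : 0 ≤ C) (hc : ∀ m, ‖c m‖ ≤ C)
    (hψ : ∀ m, ‖discreteSchrodinger c ψ m‖ ≤ X) (h0 : ‖ψ 0‖ ≤ X) (h1 : ‖ψ 1‖ ≤ X) (n : ℕ) :
    ‖ψ n‖ ≤ (C + 2) ^ n * X := by
  refine le_pow_mul_of_recurrence (u := fun n : ℕ => ‖ψ n‖) hC ((norm_nonneg _).trans h0)
    (by simpa using h0) (by simpa using h1) (fun n => ?_) n
  have hsolve : ψ ((n + 2 : ℕ) : ℤ)
      = c (n + 1) * ψ ((n + 1 : ℕ) : ℤ) - ψ n + discreteSchrodinger c ψ (n + 1) := by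
    rw [discreteSchrodinger, add_sub_cancel_right, add_assoc, one_add_one_eq_two]
    push_cast
    ring
  rw [hsolve]
  refine (norm_add_le _ _).trans (add_le_add ((norm_sub_le _ _).trans ?_) (hψ _))
  rw [norm_mul]
  gcongr
  exact hc _

theorem discreteSchrodinger_reflect (c ψ : ℤ → ℂ) (m : ℤ) :
    discreteSchrodinger (fun k => c (1 - k)) (fun k => ψ (1 - k)) m
      = discreteSchrodinger c ψ (1 - m) := by
  simp only [discreteSchrodinger]
  rw [show 1 - (m + 1) = 1 - m - 1 by ring, show 1 - (m - 1) = 1 - m + 1 by ring]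
  ring

theorem norm_le_mul_exp_log_mul (hC : 0 ≤ C) (hc : ∀ m, ‖c m‖ ≤ C)
    (hψ : ∀ m, ‖discreteSchrodinger c ψ m‖ ≤ X) (h0 : ‖ψ 0‖ ≤ X) (h1 : ‖ψ 1‖ ≤ X) (m : ℤ) :
    ‖ψ m‖ ≤ (C + 2) * X * Real.exp (Real.log (C + 2) * |(m : ℝ)|) := by
  have hX : 0 ≤ X := (norm_nonneg _).trans h0
  have hexp (n : ℕ) : Real.exp (Real.log (C + 2) * n) = (C + 2) ^ n := by
    rw [mul_comm, Real.exp_nat_mul, Real.exp_log (by linarith)]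
  obtain ⟨n, rfl | rfl⟩ := m.eq_nat_or_neg
  · simp only [Int.cast_natCast, Nat.abs_cast, hexp]
    calc ‖ψ n‖ ≤ (C + 2) ^ n * X := norm_natCast_le_pow_mul hC hc hψ h0 h1 n
      _ ≤ (C + 2) ^ (n + 1) * X := by gcongr <;> [linarith; exact n.le_succ]
      _ = (C + 2) * X * (C + 2) ^ n := by ring
  · simp only [Int.cast_neg, abs_neg, Int.cast_natCast, Nat.abs_cast, hexp]
    have hrefl := norm_natCast_le_pow_mul (ψ := fun k => ψ (1 - k)) hC (fun k => hc (1 - k))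
      (fun k => by rw [discreteSchrodinger_reflect]; exact hψ _) (by simpa using h1)
      (by simpa using h0) (n + 1)
    push_cast at hrefl
    rw [sub_add_cancel_right] at hrefl
    exact hrefl.trans_eq (by ring)

theorem le_rpow_mul_rpow {z A B : ℝ} (hz : 0 ≤ z) (hA : z ≤ A) (hB : z ≤ B) (ht0 : 0 ≤ t)
    (ht1 : t ≤ 1) : z ≤ A ^ t * B ^ (1 - t) := by
  rcases hz.eq_or_lt with rfl | hpos
  · exact mul_nonneg (Real.rpow_nonneg hA _) (Real.rpow_nonneg hB _)
  · calc z = z ^ t * z ^ (1 - t) := by rw [← Real.rpow_add hpos]; simp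
      _ ≤ A ^ t * B ^ (1 - t) := by
          have := sub_nonneg.2 ht1
          have := hz.trans hA
          gcongr

theorem le_rpow_mul_mul_exp_neg {z A B l r : ℝ} (hz : 0 ≤ z) (hA : 0 ≤ A) (hB : 1 ≤ B)
    (hl : 0 ≤ l) (hs : 0 < s) (ht0 : 0 ≤ t) (ht : t * (l + 2 * s) ≤ s) (hr : 0 ≤ r)
    (hgrow : z ≤ A * Real.exp (l * r)) (hdecay : z ≤ B * Real.exp (-(2 * s * r))) :
    z ≤ A ^ t * B * Real.exp (-(s * r)) := by
  have ht1 : t ≤ 1 := by nlinarith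
  have hexp : Real.exp (l * r) ^ t * Real.exp (-(2 * s * r)) ^ (1 - t) ≤ Real.exp (-(s * r)) := by
    rw [← Real.exp_mul, ← Real.exp_mul, ← Real.exp_add, Real.exp_le_exp]
    nlinarith
  calc z ≤ (A * Real.exp (l * r)) ^ t * (B * Real.exp (-(2 * s * r))) ^ (1 - t) :=
        le_rpow_mul_rpow hz hgrow hdecay ht0 ht1
    _ = A ^ t * B ^ (1 - t)
          * (Real.exp (l * r) ^ t * Real.exp (-(2 * s * r)) ^ (1 - t)) := by
        rw [Real.mul_rpow hA (Real.exp_pos _).le,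
          Real.mul_rpow (zero_le_one.trans hB) (Real.exp_pos _).le]
        ring
    _ ≤ A ^ t * B * Real.exp (-(s * r)) := by
        gcongr
        exact Real.rpow_le_self_of_one_le hB (by linarith)

theorem discreteSchrodinger_dotProduct {ι : Type*} [Fintype ι] (c : ℤ → ℂ) (F : ι → ℤ → ℂ)
    (ξ : ι → ℂ) (m : ℤ) :
    discreteSchrodinger c (fun m => (F · m) ⬝ᵥ ξ) m
      = (fun j => discreteSchrodinger c (F j) m) ⬝ᵥ ξ := by
  simp only [discreteSchrodinger, dotProduct, Finset.mul_sum, ← Finset.sum_add_distrib,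
    ← Finset.sum_sub_distrib]
  exact Finset.sum_congr rfl fun j _ => by ring

/-- Two rapidly decaying approximate solutions of the same equation are almost linearly dependent:
their Wronskian is small at infinity, hence at `0`, so a combination is small at `0` and `1`. The
recursion bounds this combination near `0`, its decay bounds it far away, and interpolating between
the two bounds gives smallness everywhere. -/
theorem exists_norm_dotProduct_le {F : Fin 2 → ℤ → ℂ} (hK : 1 ≤ K) (hC : 0 ≤ C) (hX : 0 ≤ X)
    (hs : 0 < s) (ht0 : 0 ≤ t) (ht : t * (Real.log (C + 2) + 2 * s) ≤ s) (n : ℕ)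
    (hc : ∀ m, ‖c m‖ ≤ C) (hF : ∀ j m, ‖discreteSchrodinger c (F j) m‖ ≤ η)
    (hFK : ∀ j, ∀ m : ℤ, ‖F j m‖ ≤ K * Real.exp (-(2 * s * |(m : ℝ)|))) (hηX : 2 * η ≤ X)
    (hn : 2 * K ^ 2 * Real.exp (-(2 * s * n)) + n * (2 * K * η) ≤ X ^ 2) :
    ∃ ξ : Fin 2 → ℂ, ‖ξ‖ = 1 ∧ ∀ m : ℤ, ‖(F · m) ⬝ᵥ ξ‖ ≤
      ((C + 2) * X) ^ t * (2 * K) * Real.exp (-(s * |(m : ℝ)|)) := by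
  have hW := (norm_wronskian_zero_le_of_decay (zero_le_one.trans hK) hs.le (hF 0) (hF 1) (hFK 0)
    (hFK 1) n).trans hn
  set A : Matrix (Fin 2) (Fin 2) ℂ := Matrix.of fun i j => F j (i : ℕ)
  have hdet : A.det = -wronskian (F 0) (F 1) 0 := by
    simp [A, Matrix.det_fin_two, wronskian]
    ring
  obtain ⟨ξ, hξ, hAξ⟩ := exists_norm_eq_one_norm_mulVec_le hX (by rwa [hdet, norm_neg])
  have hinit (i : Fin 2) : ‖(F · (i : ℕ)) ⬝ᵥ ξ‖ ≤ X := (norm_le_pi_norm _ i).trans hAξ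
  refine ⟨ξ, hξ, fun m => ?_⟩
  have hgrow := norm_le_mul_exp_log_mul (ψ := fun m => (F · m) ⬝ᵥ ξ) hC hc (X := X)
    (fun m => ?_) (hinit 0) (hinit 1) m
  · refine le_rpow_mul_mul_exp_neg (norm_nonneg _) (by positivity) (by linarith)
      (Real.log_nonneg (by linarith)) hs ht0 ht (abs_nonneg _) hgrow ?_
    exact (norm_dotProduct_le_card_mul (fun j => hFK j m) ξ).trans_eq (by simp [hξ]; ring)
  · rw [discreteSchrodinger_dotProduct]
    refine (norm_dotProduct_le_card_mul (fun j => hF j m) ξ).trans (le_of_eq_of_le ?_ hηX)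
    simp [hξ]

end DifferenceEquation

section StripNorm

variable {m n : ℕ} {ε K : ℝ} {z : ℂ}

open scoped Matrix.Norms.L2Operator in
theorem norm_entry_le_l2_opNorm (A : Matrix (Fin m) (Fin n) ℂ) (i : Fin m) (j : Fin n) :
    ‖A i j‖ ≤ ‖A‖ := by
  have hcol := A.l2_opNorm_mulVec (EuclideanSpace.single j 1)
  rw [PiLp.norm_single, norm_one, mul_one] at hcol
  refine le_trans (le_of_eq ?_) ((PiLp.norm_apply_le _ i).trans hcol)
  simp [EuclideanSpace.single]

open scoped Matrix.Norms.L2Operator in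
theorem norm_entry_le_of_stripNorm_le (hK : 0 ≤ K) {F : ℂ → Matrix (Fin m) (Fin n) ℂ}
    (h : stripNorm ε F ≤ ENNReal.ofReal K) (hz : z ∈ strip ε) (i : Fin m) (j : Fin n) :
    ‖F z i j‖ ≤ K := by
  refine (norm_entry_le_l2_opNorm (F z) i j).trans ?_
  have hsup := (le_iSup₂ (f := fun z (_ : z ∈ strip ε) => _) z hz).trans h
  rwa [← ofReal_norm, ENNReal.ofReal_le_ofReal_iff hK] at hsup

end StripNorm

section Transfer

variable {d : ℕ} {ε E E₀ : ℝ} {z : ℂ}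

theorem two_cos_two_pi_mul (z : ℂ) : 2 * Complex.cos (2 * Real.pi * z) = ex z + ex (-z) := by
  rw [Complex.two_cos, ex, ex]
  ring_nf

theorem norm_two_cos_le (hz : z ∈ strip ε) :
    ‖2 * Complex.cos (2 * Real.pi * z)‖ ≤ 2 * Real.exp (2 * Real.pi * ε) := by
  have hex {w : ℂ} (hw : |w.im| < ε) : ‖ex w‖ ≤ Real.exp (2 * Real.pi * ε) := by
    rw [norm_ex, ← mul_neg]
    gcongr
    exact (neg_le_abs w.im).trans hw.le
  rw [two_cos_two_pi_mul, two_mul]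
  exact norm_add_le_of_le (hex hz) (hex (by rwa [neg_im, abs_neg]))

/-- A bound for the entries of the transfer matrices `transfer d v E z` with `|E| ≤ E₀` and `z` in
the strip of width `ε`. -/
def transferBound (d : ℕ) (v : ℤ → ℂ) (ε E₀ : ℝ) : ℝ :=
  (E₀ + 2 * Real.exp (2 * Real.pi * ε) + ∑ j : Fin (d + d), ‖v ((d : ℤ) - 1 - (j : ℕ))‖) / ‖v d‖ + 1

theorem transferBound_nonneg (d : ℕ) (v : ℤ → ℂ) (ε : ℝ) (hE₀ : 0 ≤ E₀) :
    0 ≤ transferBound d v ε E₀ := by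
  unfold transferBound
  positivity

theorem norm_transfer_le (v : ℤ → ℂ) (hE : |E| ≤ E₀) (hz : z ∈ strip ε) (i j : Fin (d + d)) :
    ‖transfer d v E z i j‖ ≤ transferBound d v ε E₀ := by
  have hE₀ : 0 ≤ E₀ := (abs_nonneg E).trans hE
  rw [transfer, Matrix.of_apply, transferBound]
  split_ifs with hi hj hij
  · refine le_add_of_le_of_nonneg ?_ zero_le_one
    rw [norm_div]
    gcongr
    have hv := Finset.single_le_sum (f := fun j : Fin (d + d) => ‖v ((d : ℤ) - 1 - (j : ℕ))‖)
      (fun _ _ => norm_nonneg _) (Finset.mem_univ j)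
    exact norm_sub_le_of_le (norm_sub_le_of_le (by rwa [norm_real]) (norm_two_cos_le hz)) hv
  · refine le_add_of_le_of_nonneg ?_ zero_le_one
    rw [zero_sub, norm_div, norm_neg]
    gcongr
    refine le_add_of_nonneg_of_le (by positivity) ?_
    exact Finset.single_le_sum (f := fun j : Fin (d + d) => ‖v ((d : ℤ) - 1 - (j : ℕ))‖)
      (fun _ _ => norm_nonneg _) (Finset.mem_univ j)
  · rw [norm_one]
    exact le_add_of_nonneg_left (by positivity)
  · rw [norm_zero]
    positivity

/-- A Lipschitz constant of the transfer matrices for the supremum norm. -/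
def transferNorm (d : ℕ) (v : ℤ → ℂ) (ε E₀ : ℝ) : ℝ := (d + d : ℕ) * transferBound d v ε E₀

theorem transferNorm_nonneg (d : ℕ) (v : ℤ → ℂ) (ε : ℝ) (hE₀ : 0 ≤ E₀) :
    0 ≤ transferNorm d v ε E₀ :=
  mul_nonneg (Nat.cast_nonneg _) (transferBound_nonneg d v ε hE₀)

theorem norm_transfer_mulVec_le (v : ℤ → ℂ) (hE : |E| ≤ E₀) (hz : z ∈ strip ε)
    (x : Fin (d + d) → ℂ) :
    ‖(transfer d v E z).mulVec x‖ ≤ transferNorm d v ε E₀ * ‖x‖ := by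
  simpa only [Fintype.card_fin, transferNorm] using norm_mulVec_le_card_mul
    (transferBound_nonneg d v ε ((abs_nonneg E).trans hE)) (norm_transfer_le v hE hz) x

end Transfer

section HermitianSymplectic

variable {d : ℕ} {v : ℤ → ℂ} {ε K : ℝ} {B : ℂ → Matrix (Fin (d + d)) (Fin 2) ℂ} {z : ℂ}

theorem conjTranspose_star_mul_formS_mul (hε : 0 < ε)
    (hB : ∀ i j, IsStripAnalytic ε fun z => B z i j) (hH : ∀ x : ℝ, B x ∈ HSp d v)
    (hz : z ∈ strip ε) : (B (star z)).conjTranspose * formS d v * B z = formJ := by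
  ext i j
  refine eqOn_strip_of_forall_ofReal hε
    (f := fun z => ((B (star z)).conjTranspose * formS d v * B z) i j)
    (g := fun _ => formJ i j) ?_ (differentiableOn_const _) (fun x => ?_) hz
  · simp only [Matrix.mul_apply, Matrix.conjTranspose_apply]
    refine .fun_sum fun b _ => .mul (.fun_sum fun a _ => .mul_const ?_ _) (hB b j).1
    exact differentiableOn_star_star (hB a i).1
  · have hx : (B x).conjTranspose * formS d v * B x = formJ := hH x
    rw [Complex.star_def, Complex.conj_ofReal, hx]

theorem norm_formJ_mulVec (ξ : Fin 2 → ℂ) : ‖formJ.mulVec ξ‖ = ‖ξ‖ := by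
  have hJ : formJ.mulVec ξ = ![ξ 1, -ξ 0] := by
    ext i
    fin_cases i <;> simp [formJ, Matrix.mulVec, dotProduct]
  simp [hJ, Pi.norm_def, Fin.univ_succ, sup_comm]

open scoped Matrix.Norms.Operator in
/-- The constant by which the Hermitian-symplectic structure turns an upper bound for the entries
of a frame into a lower bound for its column vectors. -/
def formConst (d : ℕ) (v : ℤ → ℂ) : ℝ := (d + d : ℕ) * ‖formS d v‖

open scoped Matrix.Norms.Operator in
theorem norm_le_formConst_mul_norm_mulVec (hε : 0 < ε)
    (hB : ∀ i j, IsStripAnalytic ε fun z => B z i j) (hH : ∀ x : ℝ, B x ∈ HSp d v)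
    (hK : 0 ≤ K) (hBK : ∀ z ∈ strip ε, ∀ i j, ‖B z i j‖ ≤ K) (hz : z ∈ strip ε) (ξ : Fin 2 → ℂ) :
    ‖ξ‖ ≤ formConst d v * K * ‖(B z).mulVec ξ‖ := by
  have hadj (i : Fin 2) (j : Fin (d + d)) : ‖(B (star z)).conjTranspose i j‖ ≤ K := by
    rw [Matrix.conjTranspose_apply, norm_star]
    exact hBK _ (star_mem_strip hz) j i
  calc ‖ξ‖ = ‖(B (star z)).conjTranspose.mulVec ((formS d v).mulVec ((B z).mulVec ξ))‖ := by
        rw [Matrix.mulVec_mulVec, Matrix.mulVec_mulVec,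
          conjTranspose_star_mul_formS_mul hε hB hH hz, norm_formJ_mulVec]
    _ ≤ (d + d : ℕ) * K * (‖formS d v‖ * ‖(B z).mulVec ξ‖) := by
        refine (norm_mulVec_le_card_mul hK hadj _).trans ?_
        rw [Fintype.card_fin]
        gcongr
        exact Matrix.linfty_opNorm_mulVec _ _
    _ = formConst d v * K * ‖(B z).mulVec ξ‖ := by
        rw [formConst]
        ring

end HermitianSymplectic

section BirkhoffSums

variable {V : Type*} [NormedAddCommGroup V] [NormedSpace ℂ V] {ε C K P η ω : ℝ} {ρ : ℂ → ℂ}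
  {b b' : ℂ → V} {z : ℂ}

theorem exp_mul_norm_comp_add_le (hPη : P * η ≤ 1) (hP : 0 < P)
    (hbP : ∀ z ∈ strip ε, 1 ≤ P * ‖b z‖) (hb' : ∀ z ∈ strip ε, ‖b' z‖ ≤ C * ‖b z‖)
    (herr : ∀ z ∈ strip ε, ‖b' z - ex (ρ z) • b (z + ω)‖ ≤ η) (hz : z ∈ strip ε) :
    Real.exp (-(2 * Real.pi * (ρ z).im)) * ‖b (z + ω)‖ ≤ (C + 1) * ‖b z‖ := by
  have hη : η ≤ ‖b z‖ := le_of_mul_le_mul_left (hPη.trans (hbP z hz)) hP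
  have htri := norm_sub_norm_le (ex (ρ z) • b (z + ω)) (b' z)
  rw [norm_sub_rev, norm_smul, norm_ex] at htri
  linarith [herr z hz, hb' z hz]

theorem exp_birkhoffSum_mul_norm_le (hPη : P * η ≤ 1) (hP : 0 < P) (hC : 0 ≤ C)
    (hbP : ∀ z ∈ strip ε, 1 ≤ P * ‖b z‖) (hb' : ∀ z ∈ strip ε, ‖b' z‖ ≤ C * ‖b z‖)
    (herr : ∀ z ∈ strip ε, ‖b' z - ex (ρ z) • b (z + ω)‖ ≤ η) (hz : z ∈ strip ε) (j : ℕ) :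
    Real.exp (-(2 * Real.pi * (∑ i ∈ Finset.range j, ρ (z + (i * ω : ℝ))).im))
      * ‖b (z + (j * ω : ℝ))‖ ≤ (C + 1) ^ j * ‖b z‖ := by
  induction j with
  | zero => simp
  | succ j ih =>
    have hstep := exp_mul_norm_comp_add_le hPη hP hbP hb' herr (add_ofReal_mem_strip hz (j * ω))
    have hshift : z + (((j + 1 : ℕ) * ω : ℝ) : ℂ) = z + ((j * ω : ℝ) : ℂ) + ω := by
      push_cast
      ring
    rw [Finset.sum_range_succ, add_im, mul_add, neg_add, Real.exp_add, hshift]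
    set S := Real.exp (-(2 * Real.pi * (∑ i ∈ Finset.range j, ρ (z + (i * ω : ℝ))).im))
    calc _ = S * (Real.exp (-(2 * Real.pi * (ρ (z + (j * ω : ℝ))).im))
            * ‖b (z + (j * ω : ℝ) + ω)‖) := by rw [mul_assoc]
      _ ≤ S * ((C + 1) * ‖b (z + (j * ω : ℝ))‖) := by gcongr
      _ = (C + 1) * (S * ‖b (z + (j * ω : ℝ))‖) := by ring
      _ ≤ (C + 1) * ((C + 1) ^ j * ‖b z‖) := by gcongr
      _ = (C + 1) ^ (j + 1) * ‖b z‖ := by ring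

theorem neg_im_birkhoffSum_le (hPη : P * η ≤ 1) (hP : 0 < P) (hC : 0 ≤ C)
    (hbK : ∀ z ∈ strip ε, ‖b z‖ ≤ K)
    (hbP : ∀ z ∈ strip ε, 1 ≤ P * ‖b z‖) (hb' : ∀ z ∈ strip ε, ‖b' z‖ ≤ C * ‖b z‖)
    (herr : ∀ z ∈ strip ε, ‖b' z - ex (ρ z) • b (z + ω)‖ ≤ η) (hz : z ∈ strip ε) (j : ℕ) :
    -(∑ i ∈ Finset.range j, ρ (z + (i * ω : ℝ))).im
      ≤ j * Real.log (C + 1) + Real.log (P * K) := by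
  set S := ∑ i ∈ Finset.range j, ρ (z + (i * ω : ℝ))
  have hPK : 1 ≤ P * K := (hbP z hz).trans (mul_le_mul_of_nonneg_left (hbK z hz) hP.le)
  have hexp : Real.exp (-(2 * Real.pi * S.im)) ≤ (C + 1) ^ j * (P * K) := calc
    Real.exp (-(2 * Real.pi * S.im))
        ≤ Real.exp (-(2 * Real.pi * S.im)) * (P * ‖b (z + (j * ω : ℝ))‖) :=
          le_mul_of_one_le_right (Real.exp_pos _).le (hbP _ (add_ofReal_mem_strip hz _))
    _ = P * (Real.exp (-(2 * Real.pi * S.im)) * ‖b (z + (j * ω : ℝ))‖) := by ring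
    _ ≤ P * ((C + 1) ^ j * K) := by
        have hgrowth := exp_birkhoffSum_mul_norm_le hPη hP hC hbP hb' herr hz j
        have hbz := mul_le_mul_of_nonneg_left (hbK z hz) (by positivity : 0 ≤ (C + 1) ^ j)
        exact mul_le_mul_of_nonneg_left (hgrowth.trans hbz) hP.le
    _ = (C + 1) ^ j * (P * K) := by ring
  have hlog := (Real.le_log_iff_exp_le (by positivity)).2 hexp
  rw [Real.log_mul (by positivity) (by positivity), Real.log_pow] at hlog
  have hrhs : 0 ≤ j * Real.log (C + 1) + Real.log (P * K) := by
    have := Real.log_nonneg (le_add_of_nonneg_left hC)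
    have := Real.log_nonneg hPK
    positivity
  nlinarith [Real.pi_gt_three]

theorem im_birkhoffSum_star (hε : 0 < ε) (hρ : IsStripAnalytic ε ρ)
    (hreal : ∀ x : ℝ, (ρ x).im = 0) (ω : ℝ) (hz : z ∈ strip ε) (j : ℕ) :
    (∑ i ∈ Finset.range j, ρ (star z + (i * ω : ℝ))).im
      = -(∑ i ∈ Finset.range j, ρ (z + (i * ω : ℝ))).im := by
  rw [Complex.im_sum, Complex.im_sum, ← Finset.sum_neg_distrib]
  refine Finset.sum_congr rfl fun i _ => ?_
  have hstar : star z + ((i * ω : ℝ) : ℂ) = star (z + ((i * ω : ℝ) : ℂ)) := by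
    simp only [star_add, Complex.star_def, Complex.conj_ofReal]
  rw [hstar, apply_star_of_forall_im_ofReal_eq_zero hε hρ.1 hreal (add_ofReal_mem_strip hz _),
    Complex.star_def, Complex.conj_im]

/-- Comparing the growth of the cocycle along the section with the bounds on the section gives one
side; the other one follows by complex conjugation. -/
theorem abs_im_birkhoffSum_le (hε : 0 < ε) (hρ : IsStripAnalytic ε ρ)
    (hreal : ∀ x : ℝ, (ρ x).im = 0) (hPη : P * η ≤ 1) (hP : 0 < P) (hC : 0 ≤ C)
    (hbK : ∀ z ∈ strip ε, ‖b z‖ ≤ K)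
    (hbP : ∀ z ∈ strip ε, 1 ≤ P * ‖b z‖) (hb' : ∀ z ∈ strip ε, ‖b' z‖ ≤ C * ‖b z‖)
    (herr : ∀ z ∈ strip ε, ‖b' z - ex (ρ z) • b (z + ω)‖ ≤ η) (hz : z ∈ strip ε) (j : ℕ) :
    |(∑ i ∈ Finset.range j, ρ (z + (i * ω : ℝ))).im|
      ≤ j * Real.log (C + 1) + Real.log (P * K) := by
  have hlow := neg_im_birkhoffSum_le hPη hP hC hbK hbP hb' herr hz j
  have hup := neg_im_birkhoffSum_le hPη hP hC hbK hbP hb' herr (star_mem_strip hz) j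
  rw [im_birkhoffSum_star hε hρ hreal ω hz, neg_neg] at hup
  exact abs_le'.2 ⟨hup, hlow⟩

end BirkhoffSums

section AubryDuality

variable {d : ℕ} {v : ℤ → ℂ} {E E₀ ω η : ℝ} {l : ℂ}

/-- The index of `u_n` in the window `(u_{n+d}, …, u_{n-d})` of `2d + 1` consecutive values. -/
def center (d : ℕ) : Fin (d + d + 1) := ⟨d, by lia⟩

/-- The window `(u_{n+d}, …, u_{n-d})` of the solution of the long-range equation at phase `z` with
`(u_{n+d-1}, …, u_{n-d}) = a`. -/
def window (d : ℕ) (v : ℤ → ℂ) (E : ℝ) (z : ℂ) (a : Fin (d + d) → ℂ) : Fin (d + d + 1) → ℂ :=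
  Fin.cons ((∑ k : Fin (d + d), ((if (k : ℕ) + 1 = d then (E : ℂ) - 2 * Complex.cos
    (2 * Real.pi * z) else 0) - v ((d : ℤ) - 1 - (k : ℕ))) * a k) / v d) a

theorem window_succ (v : ℤ → ℂ) (E : ℝ) (z : ℂ) (a : Fin (d + d) → ℂ) (j : Fin (d + d)) :
    window d v E z a j.succ = a j := Fin.cons_succ _ _ _

theorem window_castSucc (v : ℤ → ℂ) (E : ℝ) (z : ℂ) (a : Fin (d + d) → ℂ) (j : Fin (d + d)) :
    window d v E z a j.castSucc = (transfer d v E z).mulVec a j := by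
  obtain ⟨_ | n, hn⟩ := j
  · simp [window, transfer, Matrix.mulVec, dotProduct, Finset.sum_div, div_mul_eq_mul_div]
  · have hprev (k : Fin (d + d)) : n = k ↔ (⟨n, by lia⟩ : Fin (d + d)) = k := by
      rw [Fin.ext_iff]
    rw [Fin.castSucc_mk, ← Fin.succ_mk _ n (by lia), window_succ]
    simp [transfer, Matrix.mulVec, dotProduct, hprev]

theorem center_eq_succ (hd : 1 ≤ d) : center d = Fin.succ ⟨d - 1, by lia⟩ :=
  Fin.ext (Nat.sub_add_cancel hd).symm

theorem sum_mul_window_add_two_cos_mul (hd : 1 ≤ d) (hv : v d ≠ 0) (E : ℝ) (z : ℂ)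
    (a : Fin (d + d) → ℂ) :
    ∑ j : Fin (d + d + 1), v ((d : ℤ) - (j : ℕ)) * window d v E z a j
      + 2 * Complex.cos (2 * Real.pi * z) * window d v E z a (center d)
      = E * window d v E z a (center d) := by
  have hcenter (k : Fin (d + d)) : (k : ℕ) + 1 = d ↔ k = ⟨d - 1, by lia⟩ := by
    rw [Fin.ext_iff]
    lia
  rw [Fin.sum_univ_succ, center_eq_succ hd]
  simp only [window, Fin.cons_zero, Fin.cons_succ, hcenter, sub_mul, ite_mul, zero_mul,
    Finset.sum_sub_distrib, Finset.sum_ite_eq', Finset.mem_univ, if_true, Fin.val_succ,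
    Fin.val_zero, Nat.cast_zero, sub_zero, mul_div_cancel₀ _ hv]
  push_cast
  simp only [← sub_sub, sub_right_comm (d : ℤ) _ 1]
  ring

/-- A family of `1`-periodic windows `(u_0, …, u_{2d})` of solutions of the long-range equation, in
which, up to an error `η`, translation by `ω` shifts the window and multiplies it by `l⁻¹`. -/
structure ApproxSolution (d : ℕ) (v : ℤ → ℂ) (E ω η : ℝ) (l : ℂ)
    (u : Fin (d + d + 1) → ℝ → ℂ) : Prop where
  continuous : ∀ j, Continuous (u j)
  periodic : ∀ j, Function.Periodic (u j) 1
  equation : ∀ x : ℝ, ∑ j : Fin (d + d + 1), v ((d : ℤ) - (j : ℕ)) * u j x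
    + 2 * Complex.cos (2 * Real.pi * x) * u (center d) x = E * u (center d) x
  shift : ∀ (j : Fin (d + d)) (x : ℝ), ‖u j.castSucc x - l * u j.succ (x + ω)‖ ≤ η

/-- The coefficient `E - ∑_{|k| ≤ d} v_k μ^k` of the dual equation. -/
def dualCoeff (d : ℕ) (v : ℤ → ℂ) (E : ℝ) (μ : ℂ) : ℂ :=
  E - ∑ j : Fin (d + d + 1), v ((d : ℤ) - (j : ℕ)) * μ ^ ((d : ℤ) - (j : ℕ))

/-- The sum `∑_{|k| ≤ d} |v_k|`. -/
def coeffMass (d : ℕ) (v : ℤ → ℂ) : ℝ := ∑ j : Fin (d + d + 1), ‖v ((d : ℤ) - (j : ℕ))‖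

theorem coeffMass_nonneg (d : ℕ) (v : ℤ → ℂ) : 0 ≤ coeffMass d v :=
  Finset.sum_nonneg fun _ _ => norm_nonneg _

theorem norm_dualCoeff_le (v : ℤ → ℂ) (hE : |E| ≤ E₀) {μ : ℂ} (hμ : ‖μ‖ = 1) :
    ‖dualCoeff d v E μ‖ ≤ E₀ + coeffMass d v := by
  refine norm_sub_le_of_le (by rwa [norm_real]) (norm_sum_le_of_le _ fun j _ => ?_)
  rw [norm_mul, norm_zpow, hμ, one_zpow, mul_one]

theorem dist_le_mul_of_dist_castSucc_succ_le {α : Type*} [PseudoMetricSpace α] {n : ℕ}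
    {V : Fin (n + 1) → α} (hη : 0 ≤ η) (h : ∀ j : Fin n, dist (V j.castSucc) (V j.succ) ≤ η)
    (i j : Fin (n + 1)) : dist (V i) (V j) ≤ n * η := by
  have hle (i j : Fin (n + 1)) (hij : i ≤ j) : dist (V i) (V j) ≤ ((j : ℕ) - (i : ℕ)) * η := by
    induction j using Fin.induction with
    | zero => simp [Fin.le_zero_iff.1 hij]
    | succ j ih =>
      rcases hij.eq_or_lt with rfl | hlt
      · simp
      · have htri := dist_triangle (V i) (V j.castSucc) (V j.succ)
        have := ih (Fin.le_castSucc_iff.2 hlt)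
        have := h j
        rw [Fin.val_castSucc] at *
        rw [Fin.val_succ]
        push_cast
        linarith
  have hcard (i j : Fin (n + 1)) : (((j : ℕ) : ℝ) - (i : ℕ)) * η ≤ n * η := by
    have hj : ((j : ℕ) : ℝ) ≤ n := by exact_mod_cast Fin.is_le j
    gcongr
    linarith [((i : ℕ).cast_nonneg : (0 : ℝ) ≤ (i : ℕ))]
  rcases le_total i j with hij | hij
  · exact (hle i j hij).trans (hcard i j)
  · rw [dist_comm]
    exact (hle j i hij).trans (hcard j i)

theorem norm_sub_zpow_mul_le {n : ℕ} {G : Fin (n + 1) → ℂ} {μ : ℂ} (hμ : ‖μ‖ = 1) (hη : 0 ≤ η)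
    (h : ∀ j : Fin n, ‖G j.castSucc - μ * G j.succ‖ ≤ η) (i j : Fin (n + 1)) :
    ‖G i - μ ^ ((j : ℤ) - (i : ℕ)) * G j‖ ≤ n * η := by
  have hμ0 : μ ≠ 0 := norm_pos_iff.1 (hμ ▸ one_pos)
  have hdist := dist_le_mul_of_dist_castSucc_succ_le (V := fun k => μ ^ (k : ℕ) * G k) hη
    (fun k => by
      rw [dist_eq_norm, Fin.val_castSucc, Fin.val_succ, pow_succ, mul_assoc, ← mul_sub, norm_mul,
        norm_pow, hμ, one_pow, one_mul]
      exact h k) i j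
  have hfactor : μ ^ (i : ℕ) * (G i - μ ^ ((j : ℤ) - (i : ℕ)) * G j)
      = μ ^ (i : ℕ) * G i - μ ^ (j : ℕ) * G j := by
    rw [mul_sub, ← mul_assoc, ← zpow_natCast μ i, ← zpow_add₀ hμ0, add_sub_cancel, zpow_natCast,
      zpow_natCast]
  rwa [dist_eq_norm, ← hfactor, norm_mul, norm_pow, hμ, one_pow, one_mul] at hdist

namespace ApproxSolution

variable {u : Fin (d + d + 1) → ℝ → ℂ}

theorem norm_fCoeff_sub_le (hu : ApproxSolution d v E ω η l u) (j : Fin (d + d)) (m : ℤ) :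
    ‖fCoeff (u j.castSucc) m - l * ex (m * ω) * fCoeff (u j.succ) m‖ ≤ η := by
  have hshift : Continuous fun x => l * u j.succ (x + ω) :=
    continuous_const.mul ((hu.continuous _).comp (continuous_add_const ω))
  rw [mul_assoc, ← fCoeff_comp_add (hu.periodic _), ← fCoeff_const_mul,
    ← fCoeff_sub (hu.continuous _) hshift]
  exact norm_fCoeff_le (hu.shift j) m

theorem fCoeff_equation (hu : ApproxSolution d v E ω η l u) (m : ℤ) :
    ∑ j : Fin (d + d + 1), v ((d : ℤ) - (j : ℕ)) * fCoeff (u j) m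
      = E * fCoeff (u (center d)) m - fCoeff (u (center d)) (m - 1)
        - fCoeff (u (center d)) (m + 1) := by
  have hcoeff (j : Fin (d + d + 1)) : Continuous fun x => v ((d : ℤ) - (j : ℕ)) * u j x :=
    continuous_const.mul (hu.continuous j)
  have hE : Continuous fun x => (E : ℂ) * u (center d) x :=
    continuous_const.mul (hu.continuous _)
  have hex (k : ℤ) : Continuous fun x : ℝ => ex (k * x) * u (center d) x :=
    ((IsStripAnalytic.ex_int_mul 1 k).continuous_ofReal one_pos).mul (hu.continuous _)
  have hEx : Continuous fun x : ℝ => E * u (center d) x - ex ((1 : ℤ) * x) * u (center d) x :=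
    hE.sub (hex 1)
  have heq : (fun x : ℝ => ∑ j : Fin (d + d + 1), v ((d : ℤ) - (j : ℕ)) * u j x) = fun x =>
      E * u (center d) x - ex ((1 : ℤ) * x) * u (center d) x
        - ex ((-1 : ℤ) * x) * u (center d) x := by
    ext x
    have hx := hu.equation x
    rw [two_cos_two_pi_mul] at hx
    simp only [Int.cast_one, Int.cast_neg, one_mul, neg_mul]
    linear_combination hx
  calc ∑ j : Fin (d + d + 1), v ((d : ℤ) - (j : ℕ)) * fCoeff (u j) m
      = fCoeff (fun x => ∑ j : Fin (d + d + 1), v ((d : ℤ) - (j : ℕ)) * u j x) m := by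
        rw [fCoeff_sum _ fun j _ => hcoeff j]
        exact Finset.sum_congr rfl fun j _ => (fCoeff_const_mul _ _ _).symm
    _ = _ := by
        rw [heq, fCoeff_sub hEx (hex (-1)), fCoeff_sub hE (hex 1), fCoeff_const_mul,
          fCoeff_ex_int_mul, fCoeff_ex_int_mul, sub_neg_eq_add]

/-- Aubry duality: the Fourier coefficients of the central component almost solve a second order
difference equation. -/
theorem norm_discreteSchrodinger_fCoeff_le (hu : ApproxSolution d v E ω η l u) (hη : 0 ≤ η)
    (hl : ‖l‖ = 1) (m : ℤ) :
    ‖discreteSchrodinger (fun m => dualCoeff d v E (l * ex (m * ω))) (fCoeff (u (center d))) m‖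
      ≤ coeffMass d v * ((d + d : ℕ) * η) := by
  set μ := l * ex (m * ω)
  have hμ : ‖μ‖ = 1 := by rw [norm_mul, hl, one_mul, norm_ex_of_im_eq_zero (by simp)]
  have hG (j : Fin (d + d + 1)) : ‖fCoeff (u j) m - μ ^ ((d : ℤ) - (j : ℕ))
      * fCoeff (u (center d)) m‖ ≤ (d + d : ℕ) * η :=
    norm_sub_zpow_mul_le (G := fun j => fCoeff (u j) m) hμ hη
      (fun j => hu.norm_fCoeff_sub_le j m) j (center d)
  have hsum : discreteSchrodinger (fun m => dualCoeff d v E (l * ex (m * ω)))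
      (fCoeff (u (center d))) m = -∑ j : Fin (d + d + 1), v ((d : ℤ) - (j : ℕ))
        * (fCoeff (u j) m - μ ^ ((d : ℤ) - (j : ℕ)) * fCoeff (u (center d)) m) := by
    simp only [discreteSchrodinger, dualCoeff, mul_sub, Finset.sum_sub_distrib, ← mul_assoc,
      ← Finset.sum_mul]
    linear_combination hu.fCoeff_equation m
  rw [hsum, norm_neg, coeffMass, Finset.sum_mul]
  refine norm_sum_le_of_le _ fun j _ => ?_
  rw [norm_mul]
  exact mul_le_mul_of_nonneg_left (hG j) (norm_nonneg _)

theorem norm_le (hu : ApproxSolution d v E ω η l u) (hη : 0 ≤ η) (hl : ‖l‖ = 1) {Y : ℝ}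
    (hY : ∀ x, ‖u (center d) x‖ ≤ Y) (j : Fin (d + d + 1)) (x : ℝ) :
    ‖u j x‖ ≤ Y + (d + d : ℕ) * η := by
  set V : Fin (d + d + 1) → ℂ := fun k => l ^ (k : ℕ) * u k (x - (j : ℕ) * ω + (k : ℕ) * ω)
  have hnorm (k : Fin (d + d + 1)) : ‖V k‖ = ‖u k (x - (j : ℕ) * ω + (k : ℕ) * ω)‖ := by
    rw [norm_mul, norm_pow, hl, one_pow, one_mul]
  have hdist := dist_le_mul_of_dist_castSucc_succ_le (V := V) hη (fun k => by
    rw [dist_eq_norm]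
    simp only [V, Fin.val_castSucc, Fin.val_succ, pow_succ, mul_assoc, ← mul_sub, norm_mul,
      norm_pow, hl, one_pow, one_mul, Nat.cast_succ, add_one_mul, ← add_assoc]
    exact hu.shift k _) j (center d)
  have htri := norm_sub_norm_le (V j) (V (center d))
  rw [← dist_eq_norm, hnorm, hnorm, sub_add_cancel] at htri
  linarith [hY (x - (j : ℕ) * ω + (center d : ℕ) * ω)]

theorem dotProduct {ι : Type*} [Fintype ι] {U : ι → Fin (d + d + 1) → ℝ → ℂ}
    (hU : ∀ i, ApproxSolution d v E ω η l (U i)) (ξ : ι → ℂ) :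
    ApproxSolution d v E ω (Fintype.card ι * η * ‖ξ‖) l fun j x => (fun i => U i j x) ⬝ᵥ ξ where
  continuous j := by
    simp only [_root_.dotProduct]
    exact continuous_finsetSum _ fun i _ => ((hU i).continuous j).mul continuous_const
  periodic j x := by simp only [(hU _).periodic j x]
  equation x := by
    simp only [_root_.dotProduct, Finset.mul_sum]
    rw [Finset.sum_comm, ← Finset.sum_add_distrib]
    refine Finset.sum_congr rfl fun i _ => ?_
    simp only [← mul_assoc]
    rw [← Finset.sum_mul, ← add_mul, (hU i).equation x]
  shift j x := by
    have hcomb : (fun i => U i j.castSucc x) ⬝ᵥ ξ - l * (fun i => U i j.succ (x + ω)) ⬝ᵥ ξ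
        = (fun i => U i j.castSucc x - l * U i j.succ (x + ω)) ⬝ᵥ ξ := by
      simp only [_root_.dotProduct, Finset.mul_sum, ← Finset.sum_sub_distrib, sub_mul, mul_assoc]
    rw [hcomb]
    exact norm_dotProduct_le_card_mul (fun i => (hU i).shift j x) ξ

end ApproxSolution

end AubryDuality

section ConstantMultiplier

variable {d : ℕ} {v : ℤ → ℂ} {E E₀ ω ε s η K P X t : ℝ} {l : ℂ}
  {A : ℂ → Matrix (Fin (d + d)) (Fin 2) ℂ}

/-- A two-dimensional section of the transfer cocycle which is invariant up to an error `η` with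
constant multiplier `l`. The bound `K` holds on the closed strip `|Im z| ≤ s / π`, and `P` measures
the nondegeneracy of the section over the real axis. -/
structure ConstantSection (d : ℕ) (v : ℤ → ℂ) (E ω ε s η K P : ℝ) (l : ℂ)
    (A : ℂ → Matrix (Fin (d + d)) (Fin 2) ℂ) : Prop where
  norm_multiplier : ‖l‖ = 1
  analytic : ∀ i j, IsStripAnalytic ε fun z => A z i j
  norm_entry_le : ∀ z : ℂ, |z.im| ≤ s / Real.pi → ∀ i j, ‖A z i j‖ ≤ K
  norm_le_mulVec : ∀ (x : ℝ) (ξ : Fin 2 → ℂ), ‖ξ‖ ≤ P * ‖(A x).mulVec ξ‖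
  norm_sub_le : ∀ (x : ℝ) i j, ‖(transfer d v E x * A x) i j - l * A (x + ω) i j‖ ≤ η

theorem continuous_window {a : ℝ → Fin (d + d) → ℂ} (ha : ∀ i, Continuous fun x => a x i)
    (j : Fin (d + d + 1)) : Continuous fun x : ℝ => window d v E x (a x) j := by
  refine j.cases ?_ ha
  simp only [window, Fin.cons_zero]
  refine (continuous_finsetSum _ fun k _ => .mul (.sub ?_ continuous_const) (ha k)).div_const _
  exact Continuous.if_const _ (by fun_prop) continuous_const

theorem window_add_one (v : ℤ → ℂ) (E : ℝ) (z : ℂ) (a : Fin (d + d) → ℂ) :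
    window d v E (z + 1) a = window d v E z a := by
  simp only [window, mul_add, mul_one, Complex.cos_add_two_pi]

theorem fCoeff_dotProduct {ι : Type*} [Fintype ι] {F : ι → ℝ → ℂ} (hF : ∀ i, Continuous (F i))
    (ξ : ι → ℂ) (m : ℤ) : fCoeff (fun x => (F · x) ⬝ᵥ ξ) m = (fun i => fCoeff (F i) m) ⬝ᵥ ξ := by
  simp only [dotProduct, mul_comm _ (ξ _)]
  rw [fCoeff_sum _ (F := fun i x => ξ i * F i x) fun i _ => continuous_const.mul (hF i)]
  simp only [fCoeff_const_mul]

namespace ConstantSection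

theorem approxSolution (h : ConstantSection d v E ω ε s η K P l A) (hd : 1 ≤ d) (hv : v d ≠ 0)
    (hε : 0 < ε) (j : Fin 2) :
    ApproxSolution d v E ω η l fun k x => window d v E x (fun i => A x i j) k where
  continuous := continuous_window fun i => (h.analytic i j).continuous_ofReal hε
  periodic k x := by
    simp only [ofReal_add, ofReal_one, window_add_one,
      (h.analytic _ j).2 x (ofReal_mem_strip hε x)]
  equation x := sum_mul_window_add_two_cos_mul hd hv E x _
  shift k x := by
    simp only [window_castSucc, window_succ, ofReal_add]
    exact h.norm_sub_le x k j

theorem norm_fCoeff_window_center_le (h : ConstantSection d v E ω ε s η K P l A) (hd : 1 ≤ d)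
    (hs : 0 < s) (hsε : s / Real.pi < ε) (j : Fin 2) (m : ℤ) :
    ‖fCoeff (fun x => window d v E x (fun i => A x i j) (center d)) m‖
      ≤ K * Real.exp (-(2 * s * |(m : ℝ)|)) := by
  have hs0 : 0 ≤ s / Real.pi := by positivity
  simp only [center_eq_succ hd, window_succ]
  refine (norm_fCoeff_le_of_norm_le (h.analytic _ j) hs0 hsε
    (fun z hz => h.norm_entry_le z hz _ j) m).trans_eq ?_
  rw [mul_assoc 2 Real.pi, mul_div_cancel₀ s Real.pi_ne_zero]

/-- The Fourier coefficients of two columns almost satisfy one second order equation, so some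
combination of the columns is small everywhere; this contradicts nondegeneracy unless the constants
are large. -/
theorem one_le_budget (h : ConstantSection d v E ω ε s η K P l A) (hd : 1 ≤ d) (hv : v d ≠ 0)
    (hE : |E| ≤ E₀) (hs : 0 < s) (hsε : s / Real.pi < ε) (hK : 1 ≤ K) (hP : 0 ≤ P) (hX : 0 ≤ X)
    (ht0 : 0 ≤ t) (ht : t * (Real.log (E₀ + coeffMass d v + 2) + 2 * s) ≤ s) (n : ℕ)
    (hηX : 2 * (coeffMass d v * ((d + d : ℕ) * η)) ≤ X)
    (hn : 2 * K ^ 2 * Real.exp (-(2 * s * n))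
      + n * (2 * K * (coeffMass d v * ((d + d : ℕ) * η))) ≤ X ^ 2) :
    1 ≤ P * (((E₀ + coeffMass d v + 2) * X) ^ t * (2 * K) * expMass s
      + (d + d : ℕ) * (2 * η)) := by
  have hε : 0 < ε := (by positivity : 0 < s / Real.pi).trans hsε
  have hη : 0 ≤ η := (norm_nonneg _).trans (h.norm_sub_le 0 ⟨0, by lia⟩ 0)
  have hC : 0 ≤ E₀ + coeffMass d v := add_nonneg ((abs_nonneg E).trans hE) (coeffMass_nonneg d v)
  have hU (j : Fin 2) := h.approxSolution hd hv hε j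
  obtain ⟨ξ, hξ, hsmall⟩ := exists_norm_dotProduct_le hK hC hX hs ht0 ht n
    (fun m => norm_dualCoeff_le v hE (by
      rw [norm_mul, h.norm_multiplier, one_mul, norm_ex_of_im_eq_zero (by simp)]))
    (fun j m => (hU j).norm_discreteSchrodinger_fCoeff_le hη h.norm_multiplier m)
    (fun j m => h.norm_fCoeff_window_center_le hd hs hsε j m) hηX hn
  have hW := ApproxSolution.dotProduct hU ξ
  rw [hξ, Fintype.card_fin, mul_one, Nat.cast_ofNat] at hW
  set Z := ((E₀ + coeffMass d v + 2) * X) ^ t * (2 * K)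
  have hcenter := norm_le_mul_expMass (Z := Z) (hW.continuous (center d)) (hW.periodic (center d))
    hs fun m => by
      rw [fCoeff_dotProduct fun j => (hU j).continuous (center d)]
      exact hsmall m
  rw [← hξ]
  refine (h.norm_le_mulVec 0 ξ).trans (mul_le_mul_of_nonneg_left ?_ hP)
  have hbound (k : Fin (d + d + 1)) := hW.norm_le (by positivity) h.norm_multiplier hcenter k 0
  refine (pi_norm_le_iff_of_nonneg ((norm_nonneg _).trans (hbound 0))).2 fun i => ?_
  have hi := hbound i.succ
  simp only [window_succ] at hi
  exact hi

end ConstantSection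

end ConstantMultiplier

section LargeDenominators

theorem eventually_add_mul_mul_exp_le_exp (A B : ℝ) {a b : ℝ} (hab : a < b) :
    ∀ᶠ n : ℕ in atTop, (A + B * n) * Real.exp (a * n) ≤ Real.exp (b * n) := by
  have hdecay (r : ℝ) := (tendsto_rpow_mul_exp_neg_mul_atTop_nhds_zero r (b - a)
    (sub_pos.2 hab)).comp tendsto_natCast_atTop_atTop
  have hlim := ((hdecay 0).const_mul A).add ((hdecay 1).const_mul B)
  simp only [mul_zero, add_zero] at hlim
  filter_upwards [hlim.eventually (eventually_le_nhds one_pos)] with n hn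
  simp only [Function.comp_apply, Real.rpow_zero, Real.rpow_one, one_mul] at hn
  have hexp : Real.exp (a * n) = Real.exp (-(b - a) * n) * Real.exp (b * n) := by
    rw [← Real.exp_add]
    ring_nf
  rw [hexp, ← mul_assoc]
  refine mul_le_of_le_one_left (Real.exp_pos _).le (le_trans (le_of_eq ?_) hn)
  ring

theorem eventually_wronskian_budget_le {m δ σ c s : ℝ} (hm : 0 ≤ m) (hσ : 0 < σ) (hδ : 16 * δ ≤ σ)
    (hσc : σ ≤ c) (hσs : σ ≤ s) : ∀ᶠ q : ℕ in atTop,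
      2 * Real.exp (δ * q) ^ 2 * Real.exp (-(2 * s * q))
        + q * (2 * Real.exp (δ * q) * (m * Real.exp (-c * q))) ≤ Real.exp (-(σ / 4) * q) ^ 2 := by
  filter_upwards [eventually_add_mul_mul_exp_le_exp 2 (2 * m)
    (by linarith : -(3 / 4 * σ) < -(σ / 2))] with q hq
  have hX : Real.exp (-(σ / 4) * q) ^ 2 = Real.exp (-(σ / 2) * q) := by
    rw [← Real.exp_nat_mul]
    ring_nf
  have hs : Real.exp (δ * q) ^ 2 * Real.exp (-(2 * s * q)) ≤ Real.exp (-(3 / 4 * σ) * q) := by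
    rw [← Real.exp_nat_mul, ← Real.exp_add, ← mul_assoc, neg_mul_eq_neg_mul, ← add_mul]
    gcongr
    push_cast
    linarith
  have hc : Real.exp (δ * q) * Real.exp (-c * q) ≤ Real.exp (-(3 / 4 * σ) * q) := by
    rw [← Real.exp_add, ← add_mul]
    gcongr
    linarith
  have hmc := mul_le_mul_of_nonneg_left hc (by positivity : 0 ≤ 2 * m * q)
  rw [hX]
  linear_combination hq + 2 * hs + hmc

theorem eventually_section_budget_lt_one {L T D δ σ t c : ℝ} (hL : 0 ≤ L) (hD : 0 ≤ D)
    (hδ : 0 < δ) (hδt : 16 * δ = σ * t) (hδc : 3 * δ ≤ c) : ∀ᶠ q : ℕ in atTop,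
      Real.exp (δ * q) * ((L * Real.exp (-(σ / 4) * q)) ^ t * (2 * Real.exp (δ * q)) * T
        + D * (2 * Real.exp (-c * q))) < 1 := by
  filter_upwards [eventually_add_mul_mul_exp_le_exp (2 * L ^ t * T + 2 * D) 0
    (by linarith : -(2 * δ) < -δ), eventually_gt_atTop 0] with q hq hq0
  have hq1 : Real.exp (-δ * q) < 1 := Real.exp_lt_one_iff.2 (by
    have : (0 : ℝ) < q := Nat.cast_pos.2 hq0
    nlinarith)
  have hrpow : (L * Real.exp (-(σ / 4) * q)) ^ t = L ^ t * Real.exp (-(4 * δ) * q) := by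
    rw [Real.mul_rpow hL (Real.exp_pos _).le, ← Real.exp_mul]
    congr 2
    linear_combination (q : ℝ) / 4 * hδt
  have hc : Real.exp (δ * q) * Real.exp (-c * q) ≤ Real.exp (-(2 * δ) * q) := by
    rw [← Real.exp_add, ← add_mul]
    gcongr
    linarith
  have hδδ : Real.exp (δ * q) * Real.exp (-(4 * δ) * q) * Real.exp (δ * q)
      = Real.exp (-(2 * δ) * q) := by
    rw [← Real.exp_add, ← Real.exp_add]
    ring_nf
  have hDc := mul_le_mul_of_nonneg_left hc (by positivity : 0 ≤ 2 * D)
  rw [hrpow]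
  linear_combination hq1 + hq + hDc + 2 * L ^ t * T * hδδ

variable {d : ℕ} {v : ℤ → ℂ} {ε s c : ℝ}

theorem exists_eventually_not_constantSection (hd : 1 ≤ d) (hv : v d ≠ 0) (hc : 0 < c) (hs : 0 < s)
    (hsε : s / Real.pi < ε) {E₀ : ℝ} (hE₀ : 0 ≤ E₀) :
    ∃ δ : ℝ, 0 < δ ∧ ∀ᶠ q : ℕ in atTop, ∀ ω E : ℝ, |E| ≤ E₀ → ∀ l A,
      ¬ ConstantSection d v E ω ε s (Real.exp (-c * q)) (Real.exp (δ * q)) (Real.exp (δ * q))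
        l A := by
  set L := E₀ + coeffMass d v + 2
  have hm := coeffMass_nonneg d v
  have hL : 0 ≤ L := by positivity
  set σ := min c s
  have hσ : 0 < σ := lt_min hc hs
  have hσc : σ ≤ c := min_le_left c s
  have hσs : σ ≤ s := min_le_right c s
  set t := s / (Real.log L + 2 * s)
  have hlog : 0 ≤ Real.log L := Real.log_nonneg (by simp only [L]; linarith)
  have ht0 : 0 < t := by positivity
  have ht : t * (Real.log L + 2 * s) = s := div_mul_cancel₀ s (by positivity)
  have ht1 : t ≤ 1 := div_le_one_of_le₀ (by linarith) (by positivity)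
  set δ := σ * t / 16 with hδ_def
  have hδ : 0 < δ := by positivity
  have hδt : 16 * δ = σ * t := by rw [hδ_def]; ring
  have hδσ : 16 * δ ≤ σ := hδt.trans_le (mul_le_of_le_one_right hσ.le ht1)
  refine ⟨δ, hδ, ?_⟩
  filter_upwards [eventually_add_mul_mul_exp_le_exp (2 * (coeffMass d v * (d + d : ℕ))) 0
      (by linarith : -c < -(σ / 4)),
    eventually_wronskian_budget_le (m := coeffMass d v * (d + d : ℕ)) (by positivity) hσ hδσ hσc
      hσs,
    eventually_section_budget_lt_one (T := expMass s) (D := (d + d : ℕ)) hL (Nat.cast_nonneg _) hδ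
      hδt (by linarith : 3 * δ ≤ c)]
    with q hsmall hwronskian hsection ω E hE l A hA
  refine hsection.not_ge (hA.one_le_budget hd hv hE hs hsε (Real.one_le_exp (by positivity))
    (Real.exp_pos _).le (Real.exp_pos _).le ht0.le ht.le q ?_ ?_)
  · rwa [zero_mul, add_zero, mul_assoc, mul_assoc] at hsmall
  · rwa [← mul_assoc (coeffMass d v)]

end LargeDenominators

section ConstantMultiplierReduction

variable {d : ℕ} {v : ℤ → ℂ} {E ω ε s η K P C b Θ γ Q κ : ℝ} {N M K₀ : ℕ} {ρ : ℂ → ℂ}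
  {B : ℂ → Matrix (Fin (d + d)) (Fin 2) ℂ}

/-- A two-dimensional section `B` of the transfer cocycle over a strip which is invariant up to an
entrywise error `η` with multiplier `e^{2πiρ}`. Here `K` bounds the entries of `B` and `P` measures
its nondegeneracy. -/
structure StripSection (d : ℕ) (v : ℤ → ℂ) (E ω ε η K P : ℝ) (ρ : ℂ → ℂ)
    (B : ℂ → Matrix (Fin (d + d)) (Fin 2) ℂ) : Prop where
  analytic_phase : IsStripAnalytic ε ρ
  phase_im : ∀ x : ℝ, (ρ x).im = 0
  analytic : ∀ i j, IsStripAnalytic ε fun z => B z i j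
  norm_entry_le : ∀ z ∈ strip ε, ∀ i j, ‖B z i j‖ ≤ K
  norm_le_mulVec : ∀ z ∈ strip ε, ∀ ξ : Fin 2 → ℂ, ‖ξ‖ ≤ P * ‖(B z).mulVec ξ‖
  norm_sub_le : ∀ z ∈ strip ε, ∀ i j,
    ‖(transfer d v E z * B z) i j - ex (ρ z) * B (z + ω) i j‖ ≤ η

theorem AlmostConjugate.exists_stripSection (h : AlmostConjugate d v E ω ε η K) (hε : 0 < ε)
    (hη : 0 ≤ η) (hK : 0 ≤ K) : ∃ ρ B, StripSection d v E ω ε η K (formConst d v * K) ρ B := by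
  obtain ⟨ρ, B, hρ, hreal, hB, hH, herr, hBK⟩ := h
  have hentry (z : ℂ) (hz : z ∈ strip ε) (i j) : ‖B z i j‖ ≤ K :=
    norm_entry_le_of_stripNorm_le hK hBK hz i j
  refine ⟨ρ, B, hρ, hreal, hB, hentry,
    fun z hz => norm_le_formConst_mul_norm_mulVec hε hB hH hK hentry hz, fun z hz i j => ?_⟩
  simpa only [Matrix.sub_apply, Matrix.mul_smul, Matrix.mul_one, Matrix.smul_apply, smul_eq_mul,
    ex] using norm_entry_le_of_stripNorm_le hη herr hz i j

theorem StripSection.birkhoffImBound (h : StripSection d v E ω ε η K P ρ B) (hε : 0 < ε)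
    (hC : 0 ≤ C) (hL : ∀ z ∈ strip ε, ∀ x, ‖(transfer d v E z).mulVec x‖ ≤ C * ‖x‖)
    (hη : 0 ≤ η) (hK : 0 ≤ K) (hPη : P * η ≤ 1) (hPK : P * K ≤ Real.exp b)
    (hΘ : N * Real.log (C + 1) + b ≤ Θ) {y : ℝ} (hy : y < ε) : BirkhoffImBound ρ ω y Θ N := by
  intro j hj z hz
  have hcol (z : ℂ) (hz : z ∈ strip ε) : 1 ≤ P * ‖fun i => B z i 0‖ := by
    have hlow := h.norm_le_mulVec z hz (Pi.single 0 1)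
    rwa [Matrix.mulVec_single_one, Pi.norm_single, norm_one] at hlow
  have hcolK (z : ℂ) (hz : z ∈ strip ε) : ‖fun i => B z i 0‖ ≤ K :=
    (pi_norm_le_iff_of_nonneg hK).2 fun i => h.norm_entry_le z hz i 0
  have hz' : z ∈ strip ε := hz.trans_lt hy
  have hP : 0 < P := pos_of_mul_pos_left (one_pos.trans_le (hcol z hz')) (norm_nonneg _)
  have hPK1 : 1 ≤ P * K := (hcol z hz').trans (mul_le_mul_of_nonneg_left (hcolK z hz') hP.le)
  have hsum := abs_im_birkhoffSum_le (b' := fun z => (transfer d v E z).mulVec fun i => B z i 0)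
    hε h.analytic_phase h.phase_im hPη hP hC hcolK hcol (fun z hz => hL z hz _)
    (fun z hz => (pi_norm_le_iff_of_nonneg hη).2 fun i => h.norm_sub_le z hz i 0) hz' j
  have hlog := (Real.log_le_iff_le_exp (one_pos.trans_le hPK1)).2 hPK
  have hjN : j * Real.log (C + 1) ≤ N * Real.log (C + 1) :=
    mul_le_mul_of_nonneg_right (Nat.cast_le.2 hj) (Real.log_nonneg (le_add_of_nonneg_left hC))
  linarith

theorem norm_ex_ofReal_sub_one_le (x : ℝ) : ‖ex x - 1‖ ≤ 2 * Real.pi * |x| := by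
  rw [ex_ofReal]
  refine (Real.norm_exp_I_mul_ofReal_sub_one_le).trans_eq ?_
  rw [Real.norm_eq_abs, abs_mul, abs_of_pos Real.two_pi_pos]

theorem norm_ex_sub_one_le {z : ℂ} (hz : z.im = 0) : ‖ex z - 1‖ ≤ 2 * Real.pi * ‖z‖ := by
  lift z to ℝ using hz
  rw [Complex.norm_real]
  exact norm_ex_ofReal_sub_one_le z

theorem StripSection.norm_gauged_sub_le (h : StripSection d v E ω ε η K P ρ B) (hε : 0 < ε)
    {g : ℂ → ℂ} (hg : ∀ x : ℝ, (g x).im = 0) {a : ℂ} (ha : a.im = 0) {r : ℝ} {x : ℝ}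
    (hr : ‖ρ x - (a + (g (x + ω) - g x))‖ ≤ r) (i j) :
    ‖(transfer d v E x * ex (g x) • B x) i j - ex a * (ex (g (x + ω)) • B (x + ω)) i j‖
      ≤ η + 2 * Real.pi * r * K := by
  set R := ρ x - (a + (g (x + ω) - g x)) with hR
  have hgω : (g (x + ω)).im = 0 := by exact_mod_cast hg (x + ω)
  have hRim : R.im = 0 := by simp [hR, h.phase_im, hg, ha, hgω]
  have hphase : ex (g x) * ex (ρ x) = ex a * ex (g (x + ω)) * ex R := by
    simp only [← ex_add, hR]
    ring_nf
  have hsplit : (transfer d v E x * ex (g x) • B x) i j - ex a * (ex (g (x + ω)) • B (x + ω)) i j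
      = ex (g x) * ((transfer d v E x * B x) i j - ex (ρ x) * B (x + ω) i j)
        + ex a * ex (g (x + ω)) * (ex R - 1) * B (x + ω) i j := by
    simp only [Matrix.mul_smul, Matrix.smul_apply, smul_eq_mul]
    linear_combination (B (x + ω) i j) * hphase
  have hx : (x : ℂ) ∈ strip ε := ofReal_mem_strip hε x
  rw [hsplit]
  refine (norm_add_le _ _).trans (add_le_add ?_ ?_)
  · rw [norm_mul, norm_ex_of_im_eq_zero (hg x), one_mul]
    exact h.norm_sub_le x hx i j
  · rw [norm_mul, norm_mul, norm_mul, norm_ex_of_im_eq_zero ha, norm_ex_of_im_eq_zero hgω, one_mul,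
      one_mul]
    exact mul_le_mul ((norm_ex_sub_one_le hRim).trans (by gcongr))
      (h.norm_entry_le _ (add_ofReal_mem_strip hx ω) i j) (norm_nonneg _)
      (mul_nonneg Real.two_pi_pos.le ((norm_nonneg _).trans hr))

theorem StripSection.constantSection (h : StripSection d v E ω ε η K P ρ B) (hs : 0 < s)
    (hsε : 2 * s / Real.pi < ε) (hΘ : BirkhoffImBound ρ ω (2 * s / Real.pi) Θ N) (hN : 0 < N)
    (hω : NonResonant ω γ Q K₀) (hκ : 0 < κ) (hQ : 0 < Q) (hκN : κ * Q ≤ N) (hγ : 2 ≤ N * γ)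
    (hK₀ : 2 / κ * Real.exp (-(s * K₀)) ≤ 1) (hM : 2 * M ≤ Q) :
    ConstantSection d v E ω ε s
      (η + 2 * Real.pi * (gaugeConst s * Θ * Real.exp (-(3 * s * M))) * K)
      (Real.exp (2 * Real.pi * (gaugeConst s * Θ)) * K) P (ex (fCoeff (fun x => ρ x) 0))
      fun z => ex (gauge ρ ω M z) • B z := by
  have hε : 0 < ε := lt_trans (by positivity) hsε
  have hreal := h.phase_im
  have hg := gauge_ofReal_im hreal ω M
  have hmean : (fCoeff (fun x => ρ x) 0).im = 0 :=
    Complex.conj_eq_iff_im.1 (by simpa using (fCoeff_neg_of_im_eq_zero hreal 0).symm)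
  refine ⟨norm_ex_of_im_eq_zero hmean, fun i j => ?_, fun z hz i j => ?_, fun x ξ => ?_,
    fun x i j => ?_⟩
  · simpa using (isStripAnalytic_gauge ε ρ ω M).ex_comp.mul (h.analytic i j)
  · have hz' : z ∈ strip ε := (hz.trans (by gcongr; linarith)).trans_lt hsε
    have hgz := norm_gauge_le hs hsε h.analytic_phase hreal hΘ hω hκ hQ hκN hγ hK₀ hM hz
    rw [Matrix.smul_apply, smul_eq_mul, norm_mul, norm_ex, ← mul_neg]
    gcongr
    · exact (neg_le_abs _).trans ((Complex.abs_im_le_norm _).trans hgz)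
    · exact h.norm_entry_le z hz' i j
  · rw [Matrix.smul_mulVec, norm_smul, norm_ex_of_im_eq_zero (hg x), one_mul]
    exact h.norm_le_mulVec x (ofReal_mem_strip hε x) ξ
  · exact h.norm_gauged_sub_le hε hg hmean
      (norm_sub_fCoeff_zero_sub_gauge_sub_le hs hsε h.analytic_phase hreal hΘ hN hω hQ hM x) i j

theorem ConstantSection.mono {η' K' P' : ℝ} {l : ℂ} (h : ConstantSection d v E ω ε s η K P l B)
    (hη : η ≤ η') (hK : K ≤ K') (hP : P ≤ P') : ConstantSection d v E ω ε s η' K' P' l B where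
  norm_multiplier := h.norm_multiplier
  analytic := h.analytic
  norm_entry_le z hz i j := (h.norm_entry_le z hz i j).trans hK
  norm_le_mulVec x ξ :=
    (h.norm_le_mulVec x ξ).trans (mul_le_mul_of_nonneg_right hP (norm_nonneg _))
  norm_sub_le x i j := (h.norm_sub_le x i j).trans hη

end ConstantMultiplierReduction

section LargeDenominatorReduction

theorem exists_mul_exp_neg_le_one (A : ℝ) {s : ℝ} (hs : 0 < s) :
    ∃ n : ℕ, A * Real.exp (-(s * n)) ≤ 1 := by
  obtain ⟨n, hn⟩ := (eventually_add_mul_mul_exp_le_exp A 0 (neg_lt_zero.2 hs)).exists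
  exact ⟨n, by simpa using hn⟩

theorem eventually_ceil_mul_add_le {κ A : ℝ} (hκ : 0 < κ) (hA : 0 ≤ A) :
    ∀ᶠ q : ℕ in atTop, ⌈κ * q⌉₊ * A + 3 * (κ * q) ≤ (2 * A + 3) * (κ * q) := by
  filter_upwards [tendsto_natCast_atTop_atTop.eventually_ge_atTop (1 / κ)] with q hq
  have hone : 1 ≤ κ * q := by rwa [div_le_iff₀' hκ] at hq
  have hceil : (⌈κ * q⌉₊ : ℝ) ≤ 2 * (κ * q) := by
    linarith [Nat.ceil_lt_add_one (zero_le_one.trans hone)]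
  linarith [mul_le_mul_of_nonneg_right hceil hA]

theorem eventually_constantSection_error_le {c c₁ s κ G : ℝ} (hG : 0 ≤ G) (hκ0 : 0 ≤ κ)
    (hc₁ : 0 < c₁) (hc : 2 * c₁ ≤ c) (hs : 2 * c₁ ≤ s) (hκ : κ ≤ c₁ / 2) : ∀ᶠ q : ℕ in atTop,
      Real.exp ((-c + κ) * q)
        + 2 * Real.pi * (G * (κ * q) * Real.exp (-(3 * s * (q / 2 : ℕ)))) * Real.exp (κ * q)
        ≤ Real.exp (-c₁ * q) := by
  filter_upwards [eventually_add_mul_mul_exp_le_exp 1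
    (2 * Real.pi * (G * κ) * Real.exp (3 * s / 2)) (by linarith : -(3 / 2 * c₁) < -c₁)] with q hq
  have hM : (q : ℝ) ≤ 2 * (q / 2 : ℕ) + 1 := by exact_mod_cast (by lia : q ≤ 2 * (q / 2) + 1)
  have hfirst : Real.exp ((-c + κ) * q) ≤ Real.exp (-(3 / 2 * c₁) * q) := by
    gcongr
    linarith
  have hsecond : Real.exp (-(3 * s * (q / 2 : ℕ))) * Real.exp (κ * q)
      ≤ Real.exp (3 * s / 2) * Real.exp (-(3 / 2 * c₁) * q) := by
    rw [← Real.exp_add, ← Real.exp_add, Real.exp_le_exp]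
    have hsM := mul_le_mul_of_nonneg_left hM (by linarith : 0 ≤ s)
    have hsκ := mul_le_mul_of_nonneg_right (by linarith : 2 * κ + 3 * c₁ ≤ 3 * s) q.cast_nonneg
    linarith
  have hscaled := mul_le_mul_of_nonneg_left hsecond
    (by positivity : 0 ≤ 2 * Real.pi * (G * (κ * q)))
  linear_combination hq + hfirst + hscaled

variable {d : ℕ} {v : ℤ → ℂ} {ε s c E₀ : ℝ}

theorem exists_eventually_constantSection (d : ℕ) (v : ℤ → ℂ) (hs : 0 < s)
    (hsε : 2 * s / Real.pi < ε) {c₁ : ℝ} (hc₁ : 0 < c₁) (hc : 2 * c₁ ≤ c) (hc₁s : 2 * c₁ ≤ s)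
    (hE₀ : 0 ≤ E₀) {δ : ℝ} (hδ : 0 < δ) :
    ∃ (κ : ℝ) (K₀ : ℕ), 0 < κ ∧ ∀ γ : ℝ, 0 < γ → ∀ᶠ q : ℕ in atTop, ∀ ω E : ℝ,
      NonResonant ω γ q K₀ → |E| ≤ E₀ →
      AlmostConjugate d v E ω ε (Real.exp ((-c + κ) * q)) (Real.exp (κ * q)) →
      ∃ l A, ConstantSection d v E ω ε s (Real.exp (-c₁ * q)) (Real.exp (δ * q))
        (Real.exp (δ * q)) l A := by
  set C := transferNorm d v ε E₀
  have hC : 0 ≤ C := transferNorm_nonneg d v ε hE₀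
  have hlog : 0 ≤ Real.log (C + 1) := Real.log_nonneg (by linarith)
  set G := gaugeConst s * (2 * Real.log (C + 1) + 3)
  have hG : 0 ≤ G := mul_nonneg (gaugeConst_nonneg hs) (by positivity)
  set κ := min (δ / (2 * Real.pi * G + 2)) (c₁ / 2)
  have hκ : 0 < κ := by positivity
  have hκδ : κ * (2 * Real.pi * G + 2) ≤ δ := (le_div_iff₀ (by positivity)).1 (min_le_left _ _)
  have hκδ' : 2 * κ ≤ δ := by linarith [(by positivity : 0 ≤ κ * (2 * Real.pi * G))]
  have hκc : κ ≤ c₁ / 2 := min_le_right _ _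
  obtain ⟨K₀, hK₀⟩ := exists_mul_exp_neg_le_one (2 / κ) hs
  refine ⟨κ, K₀, hκ, fun γ hγ => ?_⟩
  filter_upwards [eventually_add_mul_mul_exp_le_exp (formConst d v) 0 (lt_two_mul_self hκ),
    eventually_ceil_mul_add_le hκ hlog,
    eventually_constantSection_error_le hG hκ.le hc₁ hc hc₁s hκc,
    tendsto_natCast_atTop_atTop.eventually_ge_atTop (2 / (κ * γ)), eventually_gt_atTop 0]
    with q hP hΘ herr hqγ hq ω E hω hE hconj
  have hq0 : (0 : ℝ) < q := Nat.cast_pos.2 hq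
  have hN : κ * q ≤ ⌈κ * q⌉₊ := Nat.le_ceil _
  rw [zero_mul, add_zero] at hP
  obtain ⟨ρ, B, hB⟩ := hconj.exists_stripSection (lt_trans (by positivity) hsε)
    (Real.exp_pos _).le (Real.exp_pos _).le
  have hPexp (y : ℝ) : formConst d v * Real.exp (κ * q) * Real.exp y
      ≤ Real.exp (2 * κ * q + y) :=
    (mul_le_mul_of_nonneg_right hP (Real.exp_pos y).le).trans_eq (Real.exp_add _ _).symm
  have hPη : formConst d v * Real.exp (κ * q) * Real.exp ((-c + κ) * q) ≤ 1 :=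
    (hPexp _).trans (Real.exp_le_one_iff.2 (by nlinarith))
  have hPK : formConst d v * Real.exp (κ * q) * Real.exp (κ * q) ≤ Real.exp (3 * (κ * q)) :=
    (hPexp _).trans_eq (by ring_nf)
  have hbirkhoff := hB.birkhoffImBound (lt_trans (by positivity) hsε) hC
    (fun z hz x => norm_transfer_mulVec_le v hE hz x) (Real.exp_pos _).le (Real.exp_pos _).le
    hPη hPK hΘ hsε
  have hγN : 2 ≤ ⌈κ * q⌉₊ * γ := by
    rw [div_le_iff₀' (by positivity)] at hqγ
    nlinarith
  have hM : 2 * ((q / 2 : ℕ) : ℝ) ≤ q := by exact_mod_cast Nat.mul_div_le q 2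
  refine ⟨_, _, (hB.constantSection hs hsε hbirkhoff (by positivity) hω hκ hq0 hN hγN hK₀
    hM).mono ?_ ?_ (hP.trans ?_)⟩
  · rwa [← mul_assoc (gaugeConst s)]
  · rw [← mul_assoc (gaugeConst s), ← Real.exp_add]
    gcongr
    linarith [mul_le_mul_of_nonneg_right hκδ q.cast_nonneg, mul_nonneg hκ.le hq0.le]
  · gcongr

theorem exists_eventually_not_almostConjugate (hd : 1 ≤ d) (hv : v d ≠ 0) (hε : 0 < ε) (hc : 0 < c)
    (hE₀ : 0 ≤ E₀) :
    ∃ (δ : ℝ) (K₀ : ℕ), 0 < δ ∧ ∀ γ : ℝ, 0 < γ → ∀ᶠ q : ℕ in atTop, ∀ ω E : ℝ,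
      NonResonant ω γ q K₀ → |E| ≤ E₀ →
      ¬ AlmostConjugate d v E ω ε (Real.exp ((-c + δ) * q)) (Real.exp (δ * q)) := by
  have hs : 0 < Real.pi * ε / 4 := by positivity
  have hsε : 2 * (Real.pi * ε / 4) / Real.pi < ε := by
    field_simp
    linarith
  set s := Real.pi * ε / 4
  set c₁ := min c s / 2
  have hc₁ : 0 < c₁ := by positivity
  have hc₁min : 2 * c₁ = min c s := mul_div_cancel₀ _ two_ne_zero
  have hc₁c : 2 * c₁ ≤ c := hc₁min.trans_le (min_le_left c s)
  have hc₁s : 2 * c₁ ≤ s := hc₁min.trans_le (min_le_right c s)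
  obtain ⟨δ, hδ, hnot⟩ := exists_eventually_not_constantSection hd hv hc₁ hs
    (lt_of_le_of_lt (by gcongr; linarith) hsε) hE₀
  obtain ⟨κ, K₀, hκ, hsection⟩ := exists_eventually_constantSection d v hs hsε hc₁ hc₁c hc₁s hE₀ hδ
  refine ⟨κ, K₀, hκ, fun γ hγ => ?_⟩
  filter_upwards [hnot, hsection γ hγ] with q hnot hsection ω E hω hE hconj
  obtain ⟨l, A, hA⟩ := hsection ω E hω hE hconj
  exact hnot ω E hE l A hA

end LargeDenominatorReduction

section Convergents

variable {α : ℝ}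

theorem not_terminatedAt_of_irrational (hα : Irrational α) (n : ℕ) :
    ¬(GenContFract.of α).TerminatedAt n := by
  intro h
  obtain ⟨r, hr⟩ := (GenContFract.terminates_iff_rat α).1 ⟨n, h⟩
  exact hα ⟨r, hr.symm⟩

theorem exists_int_contsAux (α : ℝ) (n : ℕ) :
    ∃ a b : ℤ, (GenContFract.of α).contsAux n = ⟨a, b⟩ := by
  induction n using Nat.twoStepInduction with
  | zero => exact ⟨1, 0, by simp [GenContFract.contsAux]⟩
  | one => exact ⟨⌊α⌋, 1, by simp [GenContFract.contsAux, GenContFract.of_h_eq_floor]⟩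
  | more n ih ih' =>
    obtain ⟨a, b, hab⟩ := ih
    obtain ⟨a', b', hab'⟩ := ih'
    rcases hs : (GenContFract.of α).s.get? n with _ | gp
    · rw [GenContFract.contsAux_stable_step_of_terminated hs]
      exact ⟨a', b', hab'⟩
    · obtain ⟨hnum, w, hden⟩ := GenContFract.of_partNum_eq_one_and_exists_int_partDen_eq hs
      rw [GenContFract.contsAux_recurrence hs hab hab']
      exact ⟨w * a' + a, w * b' + b, by simp [hnum, hden]⟩

theorem exists_int_nums_dens (α : ℝ) (n : ℕ) :
    ∃ a b : ℤ, (GenContFract.of α).nums n = a ∧ (GenContFract.of α).dens n = b := by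
  obtain ⟨a, b, hab⟩ := exists_int_contsAux α (n + 1)
  refine ⟨a, b, ?_, ?_⟩
  · rw [GenContFract.num_eq_conts_a, GenContFract.nth_cont_eq_succ_nth_contAux, hab]
  · rw [GenContFract.den_eq_conts_b, GenContFract.nth_cont_eq_succ_nth_contAux, hab]

theorem q_mono (α : ℝ) : Monotone (q α) :=
  monotone_nat_of_le_succ fun _ => GenContFract.of_den_mono

theorem one_le_q (α : ℝ) (n : ℕ) : 1 ≤ q α n := by
  have hzero : q α 0 = 1 := by simp [q]
  exact hzero.ge.trans (q_mono α n.zero_le)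

theorem q_pos (α : ℝ) (n : ℕ) : 0 < q α n := one_pos.trans_le (one_le_q α n)

theorem exists_isCoprime_conv (hα : Irrational α) (n : ℕ) :
    ∃ (a : ℤ) (b : ℕ), q α n = b ∧ conv α n = a / b ∧ IsCoprime a (b : ℤ) := by
  obtain ⟨a, b, ha, hb⟩ := exists_int_nums_dens α n
  obtain ⟨a', b', ha', hb'⟩ := exists_int_nums_dens α (n + 1)
  have hconv : conv α n = a / b := by rw [conv, GenContFract.conv_eq_num_div_den, ha, hb]
  have hdet : (GenContFract.of α).nums n * (GenContFract.of α).dens (n + 1)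
      - (GenContFract.of α).dens n * (GenContFract.of α).nums (n + 1) = (-1) ^ (n + 1) :=
    SimpContFract.determinant (s := SimpContFract.of α) (not_terminatedAt_of_irrational hα n)
  rw [ha, hb, ha', hb'] at hdet
  have hdetZ : a * b' - b * a' = (-1) ^ (n + 1) := by exact_mod_cast hdet
  have hb0 : 0 ≤ b := by
    have hpos : (0 : ℝ) < b := hb ▸ q_pos α n
    exact_mod_cast hpos.le
  lift b to ℕ using hb0
  refine ⟨a, b, hb, by exact_mod_cast hconv, (-1) ^ (n + 1) * b', -((-1) ^ (n + 1) * a'), ?_⟩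
  have hsq : (-1 : ℤ) ^ (n + 1) * (-1) ^ (n + 1) = 1 := by simp [← mul_pow]
  linear_combination (-1) ^ (n + 1) * hdetZ + hsq

theorem abs_sub_conv_le (hα : Irrational α) (n : ℕ) : |α - conv α n| ≤ 1 / q α n ^ 2 := by
  have hq := q_pos α n
  refine (GenContFract.abs_sub_convs_le (not_terminatedAt_of_irrational hα n)).trans ?_
  change 1 / (q α n * q α (n + 1)) ≤ _
  rw [sq]
  gcongr
  exact q_mono α n.le_succ

theorem beta_nonneg (α : ℝ) : 0 ≤ beta α :=
  le_limsup_of_frequently_le (Frequently.of_forall fun n => EReal.coe_nonneg.2 <|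
    div_nonneg (Real.log_nonneg (one_le_q α (n + 1))) (q_pos α n).le) (by isBoundedDefault)

theorem exists_strictMono_exp_lt_q (α : ℝ) :
    ∃ φ : ℕ → ℕ, StrictMono φ ∧ ∀ b : ℝ, (b : EReal) < beta α → ∀ᶠ n in atTop,
      Real.exp (b * q α (φ n)) < q α (φ n + 1) := by
  have hbot : ⊥ < beta α := EReal.bot_lt_zero.trans_le (beta_nonneg α)
  obtain ⟨u, -, hu, hutendsto⟩ := exists_seq_strictMono_tendsto' hbot
  obtain ⟨φ, hφ, hlt⟩ := extraction_forall_of_frequently fun n =>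
    frequently_lt_of_lt_limsup (by isBoundedDefault) (hu n).2
  refine ⟨φ, hφ, fun b hb => ?_⟩
  filter_upwards [hutendsto.eventually (lt_mem_nhds hb)] with n hn
  have hlog : b < Real.log (q α (φ n + 1)) / q α (φ n) := EReal.coe_lt_coe_iff.1 (hn.trans (hlt n))
  rw [lt_div_iff₀ (q_pos α _)] at hlog
  exact (Real.lt_log_iff_exp_lt (q_pos α _)).1 hlog

end Convergents

section RationalApproximation

variable {α ω : ℝ} {a k : ℤ} {b : ℕ}

theorem two_mul_abs_le_norm_ex_sub_one {x : ℝ} (hx : |x| ≤ 1 / 2) : 2 * |x| ≤ ‖ex x - 1‖ := by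
  have hhalf : 2 * Real.pi * x / 2 = Real.pi * x := by ring
  have habs : |Real.pi * x| = Real.pi * |x| := by rw [abs_mul, abs_of_pos Real.pi_pos]
  rw [ex_ofReal, Complex.norm_exp_I_mul_ofReal_sub_one, norm_mul, Real.norm_eq_abs,
    Real.norm_eq_abs, abs_two, hhalf]
  calc 2 * |x| ≤ 2 * (2 * |x|) := by linarith [abs_nonneg x]
    _ = 2 * (2 / Real.pi * |Real.pi * x|) := by rw [habs]; field_simp
    _ ≤ 2 * |Real.sin (Real.pi * x)| := by
      gcongr
      refine Real.mul_abs_le_abs_sin ?_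
      rw [habs]
      linarith [mul_le_mul_of_nonneg_left hx Real.pi_pos.le]

theorem one_le_abs_mul_sub_mul (hab : IsCoprime a (b : ℤ)) (hk : k ≠ 0) (hkb : |k| < b) (r : ℤ) :
    1 ≤ |k * a - r * b| := by
  refine Int.one_le_abs fun h => hkb.not_ge ?_
  have hdvd : (b : ℤ) ∣ k := hab.symm.dvd_of_dvd_mul_right ⟨r, by linarith⟩
  exact Int.le_of_dvd (abs_pos.2 hk) ((dvd_abs _ _).2 hdvd)

theorem one_div_two_mul_le_abs_mul_sub (hab : IsCoprime a (b : ℤ))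
    (hω : |ω - a / b| ≤ 1 / (b : ℝ) ^ 2) (hk : k ≠ 0) (hkb : 2 * |k| ≤ b) (r : ℤ) :
    1 / (2 * (b : ℝ)) ≤ |k * ω - r| := by
  have hk1 : 1 ≤ |k| := Int.one_le_abs hk
  have hb : (0 : ℝ) < b := by exact_mod_cast (by omega : 0 < b)
  have hkbR : 2 * |(k : ℝ)| ≤ b := by exact_mod_cast hkb
  have hnum : 1 ≤ |(k * a - r * b : ℝ)| := by
    exact_mod_cast one_le_abs_mul_sub_mul hab hk (by omega) r
  have hrat : 1 / (b : ℝ) ≤ |(k * (a / b) - r : ℝ)| := calc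
    1 / (b : ℝ) ≤ |(k * a - r * b : ℝ)| / b := by gcongr
    _ = |(k * a - r * b) / (b : ℝ)| := by rw [abs_div, Nat.abs_cast]
    _ = |(k * (a / b) - r : ℝ)| := by congr 1; field_simp
  have herror : |k * (ω - a / b)| ≤ 1 / (2 * (b : ℝ)) := calc
    |k * (ω - a / b)| = |(k : ℝ)| * |ω - a / b| := abs_mul _ _
    _ ≤ b / 2 * (1 / (b : ℝ) ^ 2) := by gcongr; linarith
    _ = 1 / (2 * (b : ℝ)) := by field_simp
  have htriangle : |(k * (a / b) - r : ℝ)| ≤ |k * ω - r| + |k * (ω - a / b)| := by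
    refine le_of_eq_of_le ?_ (abs_sub _ _)
    ring_nf
  have hhalves : 1 / (b : ℝ) = 1 / (2 * b) + 1 / (2 * b) := by field_simp; norm_num
  linarith

theorem one_div_le_norm_ex_sub_one (hab : IsCoprime a (b : ℤ))
    (hω : |ω - a / b| ≤ 1 / (b : ℝ) ^ 2) (hk : k ≠ 0) (hkb : 2 * |k| ≤ b) :
    1 / (b : ℝ) ≤ ‖ex (k * ω) - 1‖ := by
  have hex : ex ((k * ω - round (k * ω) : ℝ) : ℂ) = ex (k * ω) := by
    rw [← mul_one (ex _), ← ex_intCast (round (k * ω)), ← ex_add]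
    push_cast
    ring_nf
  calc 1 / (b : ℝ) = 2 * (1 / (2 * b)) := by field_simp
    _ ≤ 2 * |k * ω - round (k * ω)| := by
      gcongr
      exact one_div_two_mul_le_abs_mul_sub hab hω hk hkb _
    _ ≤ ‖ex (k * ω) - 1‖ := hex ▸ two_mul_abs_le_norm_ex_sub_one (abs_sub_round (k * ω))

theorem ex_intCast_mul_ne_one (hα : Irrational α) (hk : k ≠ 0) : ex (k * α) ≠ 1 := by
  rw [ex, Ne, Complex.exp_eq_one_iff]
  rintro ⟨m, hm⟩
  have hkα : (k : ℂ) * α = m := mul_left_cancel₀ Complex.two_pi_I_ne_zero (by rw [hm, mul_comm])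
  exact (hα.intCast_mul hk).ne_int m (by exact_mod_cast hkα)

theorem exists_eventually_le_norm_ex_sub_one (hα : Irrational α) (K₀ : ℕ) :
    ∃ γ : ℝ, 0 < γ ∧ ∀ᶠ ω : ℝ in 𝓝 α, ∀ k : ℤ, k ≠ 0 → |k| ≤ K₀ → γ ≤ ‖ex (k * ω) - 1‖ := by
  set S := (Finset.Icc (-(K₀ : ℤ)) K₀).erase 0
  have hγ : ∀ᶠ γ : ℝ in 𝓝[>] 0, ∀ k ∈ S, γ < ‖ex (k * α) - 1‖ := by
    refine (eventually_all_finset S).2 fun k hk => nhdsWithin_le_nhds (gt_mem_nhds ?_)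
    exact norm_pos_iff.2 (sub_ne_zero.2 (ex_intCast_mul_ne_one hα (Finset.ne_of_mem_erase hk)))
  obtain ⟨γ, hlt, hγ0⟩ := (hγ.and self_mem_nhdsWithin).exists
  have hω : ∀ᶠ ω : ℝ in 𝓝 α, ∀ k ∈ S, γ < ‖ex (k * ω) - 1‖ := by
    refine (eventually_all_finset S).2 fun k hk => ?_
    have hcont : Continuous fun ω : ℝ => ‖ex (k * ω) - 1‖ :=
      ((continuous_ex.comp (by fun_prop)).sub continuous_const).norm
    exact hcont.continuousAt.eventually (lt_mem_nhds (hlt k hk))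
  refine ⟨γ, hγ0, hω.mono fun ω hω k hk hkK₀ => (hω k ?_).le⟩
  exact Finset.mem_erase.2 ⟨hk, Finset.mem_Icc.2 (abs_le.1 hkK₀)⟩

theorem exists_nonResonant (hα : Irrational α) (K₀ : ℕ) :
    ∃ γ : ℝ, 0 < γ ∧ ∀ᶠ n in atTop, ∀ ω : ℝ, ω = α ∨ ω = conv α n →
      NonResonant ω γ (q α n) K₀ := by
  obtain ⟨γ, hγ, hlow⟩ := exists_eventually_le_norm_ex_sub_one hα K₀
  refine ⟨γ, hγ, ?_⟩
  filter_upwards [(GenContFract.of_convergence α).eventually hlow] with n hn ω hω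
  refine ⟨?_, fun k hk hkq => ?_⟩
  · rcases hω with rfl | rfl
    exacts [hlow.self_of_nhds, hn]
  obtain ⟨a, b, hq, hconv, hab⟩ := exists_isCoprime_conv hα n
  have happrox : |ω - conv α n| ≤ 1 / q α n ^ 2 := by
    rcases hω with rfl | rfl
    · exact abs_sub_conv_le hα n
    · rw [sub_self, abs_zero]
      positivity
  rw [hq] at hkq happrox ⊢
  rw [hconv] at happrox
  exact one_div_le_norm_ex_sub_one hab happrox hk (by exact_mod_cast hkq)

end RationalApproximation

section NonConjugacy

variable {d : ℕ} {v : ℤ → ℂ} {ε c : ℝ}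

theorem exists_forall_convergent_not_almostConjugate (hd : 1 ≤ d) (hv : v d ≠ 0) (hε : 0 < ε)
    (hc : 0 < c) (E₀ : ℝ) :
    ∃ δ : ℝ, 0 < δ ∧ ∀ α : ℝ, Irrational α → ∃ qs : ℝ, 0 < qs ∧ ∀ n : ℕ, qs < q α n →
      ∀ ω : ℝ, ω = α ∨ ω = conv α n → ∀ E : ℝ, |E| ≤ E₀ →
        ¬AlmostConjugate d v E ω ε (Real.exp ((-c + δ) * q α n)) (Real.exp (δ * q α n)) := by
  obtain ⟨δ, K₀, hδ, hnot⟩ := exists_eventually_not_almostConjugate hd hv hε hc (abs_nonneg E₀)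
  refine ⟨δ, hδ, fun α hα => ?_⟩
  obtain ⟨γ, hγ, hres⟩ := exists_nonResonant hα K₀
  obtain ⟨Q, hQ⟩ := eventually_atTop.1 (hnot γ hγ)
  obtain ⟨n₀, hn₀⟩ := eventually_atTop.1 hres
  refine ⟨max Q (q α n₀), lt_max_of_lt_right (q_pos α n₀), fun n hn ω hω E hE => ?_⟩
  have hnn₀ : n₀ ≤ n := ((q_mono α).reflect_lt ((le_max_right _ _).trans_lt hn)).le
  have hresn := hn₀ n hnn₀ ω hω
  obtain ⟨a, b, hq, -⟩ := exists_isCoprime_conv hα n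
  rw [hq] at hn hresn ⊢
  have hQb : Q ≤ b := by exact_mod_cast ((le_max_left _ _).trans_lt hn).le
  exact hQ b hQb ω E hresn (hE.trans (le_abs_self E₀))

end NonConjugacy

end LongRange

end

theorem proposition7p1_general (d : ℕ) (hd : 1 ≤ d) (v : ℤ → ℂ) (hv : v d ≠ 0) (ε c : ℝ)
    (hε : 0 < ε) (hc : 0 < c) (E₀ : ℝ) :
    ∃ δ : ℝ, 0 < δ ∧ ∀ α : ℝ, Irrational α → ∃ (qs : ℝ) (φ : ℕ → ℕ), 0 < qs ∧ StrictMono φ ∧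
      (∀ b : ℝ, (b : EReal) < LongRange.beta α → ∀ᶠ n in Filter.atTop,
        Real.exp (b * LongRange.q α (φ n)) < LongRange.q α (φ n + 1)) ∧
      ∀ n : ℕ, qs < LongRange.q α n → ∀ ω : ℝ, ω = α ∨ ω = LongRange.conv α n →
        ∀ E : ℝ, |E| ≤ E₀ →
          ¬ LongRange.AlmostConjugate d v E ω ε (Real.exp ((-c + δ) * LongRange.q α n))
              (Real.exp (δ * LongRange.q α n)) := by
  obtain ⟨δ, hδ, hnot⟩ :=
    LongRange.exists_forall_convergent_not_almostConjugate hd hv hε hc E₀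
  refine ⟨δ, hδ, fun α hα => ?_⟩
  obtain ⟨qs, hqs, hnotα⟩ := hnot α hα
  obtain ⟨φ, hφ, hgrowth⟩ := LongRange.exists_strictMono_exp_lt_q α
  exact ⟨qs, φ, hqs, hφ, hgrowth, hnotα⟩

theorem proposition7p1 (α : ℝ) (hα : Irrational α) (d : ℕ) (hd : 1 ≤ d) (v : ℤ → ℂ)
    (hv : LongRange.IsRealTrigPoly d v) (ε c : ℝ) (hε : 0 < ε) (hc : 0 < c) :
    ∃ (δ qs : ℝ) (φ : ℕ → ℕ), 0 < δ ∧ 0 < qs ∧ StrictMono φ ∧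
      (∀ n : ℕ, qs < LongRange.q α (φ n) →
        ∀ E : ℝ, |E| ≤ 3 + ⨆ x : ℝ, ‖LongRange.potential d v x‖ →
          ¬ LongRange.AlmostConjugate d v E α ε
              (Real.exp ((-c + δ) * LongRange.q α (φ n)))
              (Real.exp (δ * LongRange.q α (φ n)))) ∧
      (0 < LongRange.beta α →
        (∀ b : ℝ, (b : EReal) < LongRange.beta α → ∀ᶠ n in Filter.atTop,
          Real.exp (b * LongRange.q α (φ n)) < LongRange.q α (φ n + 1)) ∧
        (∀ n : ℕ, qs < LongRange.q α (φ n) →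
          ∀ E : ℝ, |E| ≤ 3 + ⨆ x : ℝ, ‖LongRange.potential d v x‖ →
            ¬ LongRange.AlmostConjugate d v E (LongRange.conv α (φ n)) ε
                (Real.exp ((-c + δ) * LongRange.q α (φ n)))
                (Real.exp (δ * LongRange.q α (φ n))))) := by
  obtain ⟨δ, hδ, h⟩ := proposition7p1_general d hd v hv.leading ε c hε hc
    (3 + ⨆ x : ℝ, ‖LongRange.potential d v x‖)
  obtain ⟨qs, φ, hqs, hφ, hgrowth, hnot⟩ := h α hα
  exact ⟨δ, qs, φ, hδ, hqs, hφ, fun n hn => hnot _ hn _ (.inl rfl),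
    fun _ => ⟨hgrowth, fun n hn => hnot _ hn _ (.inr rfl)⟩⟩
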